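/- Let $(T_i)_{i\ge 1}$ be a strictly stationary and ergodic sequence of real random variables which is a (first order) Markov sequence; for instance, the sequence of the inter-event intervals $T_i>0$ of a simple point process. (Positivity of the $T_i$ is allowed but is not assumed.) Assume that $T_1$ has a density $f\in C_0(\mathbb R)$ and that $(T_1,T_2)$ has a density $(\tau,t)\mapsto f(\tau,t)$ in $C_0(\mathbb R^2)$, where $C_0$ denotes the continuous functions vanishing at infinity. Assume further that for every $i\ge 2$ and almost every past $(T_1,\dots,T_{i-1})$: * the conditional law of $T_i$ given $T_1,\dots,T_{i-1}$ has a density $f_i(\cdot\mid T_1,\dots,T_{i-1})\in C_0(\mathbb R)$ with $|f_i(t\mid\cdot)-f_i(t'\mid\cdot)|\le|t-t'|$ for all $t,t'$; * the conditional law of $(T_i,T_{i+1})$ given $T_1,\dots,T_{i-1}$ has a density $f_i(\cdot,\cdot\mid T_1,\dots,T_{i-1})\in C_0(\mathbb R^2)$ with $|f_i(\tau,t\mid\cdot)-f_i(\tau',t'\mid\cdot)|\le|\tau-\tau'|+|t-t'|$ for all $\tau,t,\tau',t'$. Put $$S(t)=1-\int_0^t f(s)\,ds,\quad h(t)=\frac{f(t)}{S(t)},\qquad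 f(t\mid\tau)=\frac{f(\tau,t)}{f(\tau)},\quad S(t\mid\tau)=1-\int_0^t f(s\mid\tau)\,ds,\quad h(t\mid\tau)=\frac{f(t\mid\tau)}{S(t\mid\tau)} .$$ Let $M>0$ and $0\le a\le M$. Assume that $f>\gamma_0$ on an $\varepsilon$-neighbourhood of $[a,M]$ in $\mathbb R$ for some $\varepsilon,\gamma_0>0$, and that $S(t\mid\tau)>0$ for all $(\tau,t)\in[a,M]\times[0,M]$. Let $K_1,K_2:\mathbb R\to[0,\infty)$ be kernels of bounded variation with $\int K_j=1$ and $|t|K_j(t)\to0$ as $|t|\to\infty$, with $K_1$ strictly positive, and with $|K_j(t)-K_j(t')|\le\mathfrak L|t-t'|^{\gamma}$ for all $t,t'$, for some $\mathfrak L<\infty$ and $\gamma\in[0,1]$. Let $b_n>0$ with $b_n\to0$ and $n b_n^4/\ln n\to\infty$, and put $$\hat f_n(t)=\frac1{nb_n}\sum_{i=1}^nK_1\Big(\frac{t-T_i}{b_n}\Big),\qquad \hat f_n(\tau,t)=\frac1{nb_n^2}\sum_{i=1}^nK_1\Big(\frac{\tau-T_i}{b_n}\Big)K_2\Big(\frac{t-T_{i+1}}{b_n}\Big),\qquad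 \hat f_n(t\mid\tau)=\frac{\hat f_n(\tau,t)}{\hat f_n(\tau)},$$ $$\hat S_n(t)=1-\int_0^t\hat f_n(s)\,ds,\quad \hat h_n(t)=\frac{\hat f_n(t)}{\hat S_n(t)},\qquad \hat S_n(t\mid\tau)=1-\int_0^t\hat f_n(s\mid\tau)\,ds,\quad \hat h_n(t\mid\tau)=\frac{\hat f_n(t\mid\tau)}{\hat S_n(t\mid\tau)}.$$ Then, almost surely, $$\lim_{n\to\infty}\ \sup_{t\in[0,M]}\big|\hat h_n(t)-h(t)\big|=0\qquad\text{and}\qquad \lim_{n\to\infty}\ \sup_{(\tau,t)\in[a,M]\times[0,M]}\big|\hat h_n(t\mid\tau)-h(t\mid\tau)\big|=0 .$$ In particular, for $a=0$ the second convergence is uniform on $[0,M]^2$. -/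

import Mathlib

open MeasureTheory ProbabilityTheory Filter Topology Set
open scoped NNReal ENNReal

noncomputable section

/-! ### Stationary, ergodic, Markov sequences of real random variables

The random variables are indexed from `0`: `T 0, T 1, …` are the successive intervals
`T_1, T_2, …`. -/

/-- The shift of a real sequence. -/
def seqShift (x : ℕ → ℝ) : ℕ → ℝ := fun i => x (i + 1)

/-- The law of the whole sequence `(T i)`, a measure on `ℕ → ℝ`. -/
def seqLaw {Ω : Type*} [MeasurableSpace Ω] (T : ℕ → Ω → ℝ) (μ : Measure Ω) :
    Measure (ℕ → ℝ) :=
  μ.map (fun ω i => T i ω)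

/-- Strict stationarity: the law of the sequence is invariant under the shift. -/
def IsStationarySeq {Ω : Type*} [MeasurableSpace Ω] (T : ℕ → Ω → ℝ) (μ : Measure Ω) : Prop :=
  MeasurePreserving seqShift (seqLaw T μ) (seqLaw T μ)

/-- Ergodicity: every shift-invariant event has probability zero or one. -/
def IsErgodicSeq {Ω : Type*} [MeasurableSpace Ω] (T : ℕ → Ω → ℝ) (μ : Measure Ω) : Prop :=
  PreErgodic seqShift (seqLaw T μ)

/-- The past `(T 0, …, T n)` up to the index `n`. -/
def past {Ω : Type*} (T : ℕ → Ω → ℝ) (n : ℕ) (ω : Ω) : Fin (n + 1) → ℝ := fun j => T j ω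

/-- The (first order) Markov property: the conditional law of `T (n + 1)` given
`T 0, …, T n` is its conditional law given `T n`. -/
def IsMarkovSeq {Ω : Type*} [MeasurableSpace Ω] (T : ℕ → Ω → ℝ) (μ : Measure Ω) : Prop :=
  ∀ n : ℕ, ∀ B : Set ℝ, MeasurableSet B →
    μ⟦T (n + 1) ⁻¹' B | MeasurableSpace.comap (past T n) inferInstance⟧
      =ᵐ[μ] μ⟦T (n + 1) ⁻¹' B | MeasurableSpace.comap (T n) inferInstance⟧

/-! ### Densities -/

/-- `f` is a (pointwise given, nonnegative) probability density of `P`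
with respect to the Lebesgue measure. -/
def IsDensityOf {E : Type*} [MeasureSpace E] (f : E → ℝ) (P : Measure E) : Prop :=
  (∀ x, 0 ≤ f x) ∧ P = volume.withDensity (fun x => ENNReal.ofReal (f x))

/-- The space `C₀(E)` of continuous functions which vanish at infinity. -/
def IsC0 {E : Type*} [TopologicalSpace E] (f : E → ℝ) : Prop :=
  Continuous f ∧ Tendsto f (cocompact E) (𝓝 0)

/-- The conditional density `t ↦ f(t | τ) = f(τ, t) / f(τ)`. -/
def condDensity (f : ℝ → ℝ) (f₂ : ℝ × ℝ → ℝ) (τ t : ℝ) : ℝ := f₂ (τ, t) / f τ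

/-- `S(t) = 1 - ∫₀ᵗ g(s) ds`. -/
def survival (g : ℝ → ℝ) (t : ℝ) : ℝ := 1 - ∫ s in (0 : ℝ)..t, g s

/-- The hazard rate function `g(t) / S(t)`. -/
def hazard (g : ℝ → ℝ) (t : ℝ) : ℝ := g t / survival g t

/-! ### Kernels and estimators -/

/-- The standing assumptions on a kernel: nonnegative, of integral one, of bounded variation,
with `|t| K(t) → 0` as `|t| → ∞`. -/
structure IsKernel (K : ℝ → ℝ) : Prop where
  nonneg : ∀ t, 0 ≤ K t
  integrable : Integrable K
  integral_eq_one : ∫ t, K t = 1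
  tendsto_zero : Tendsto (fun t => |t| * K t) (cocompact ℝ) (𝓝 0)
  boundedVariation : BoundedVariationOn K univ

/-- `f̂ₙ(t) = (n bₙ)⁻¹ ∑_{i ≤ n} K₁((t - T_i) / bₙ)`. -/
def densEst {Ω : Type*} (K₁ : ℝ → ℝ) (b : ℕ → ℝ) (T : ℕ → Ω → ℝ) (n : ℕ) (ω : Ω)
    (t : ℝ) : ℝ :=
  1 / (n * b n) * ∑ i ∈ Finset.range n, K₁ ((t - T i ω) / b n)

/-- `f̂ₙ(τ, t) = (n bₙ²)⁻¹ ∑_{i ≤ n} K₁((τ - T_i) / bₙ) K₂((t - T_{i+1}) / bₙ)`. -/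
def jointDensEst {Ω : Type*} (K₁ K₂ : ℝ → ℝ) (b : ℕ → ℝ) (T : ℕ → Ω → ℝ) (n : ℕ) (ω : Ω)
    (p : ℝ × ℝ) : ℝ :=
  1 / (n * b n ^ 2) *
    ∑ i ∈ Finset.range n, K₁ ((p.1 - T i ω) / b n) * K₂ ((p.2 - T (i + 1) ω) / b n)

/-- The hazard rate estimator `ĥₙ(t) = f̂ₙ(t) / Ŝₙ(t)`. -/
def hazardEst {Ω : Type*} (K₁ : ℝ → ℝ) (b : ℕ → ℝ) (T : ℕ → Ω → ℝ) (n : ℕ) (ω : Ω)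
    (t : ℝ) : ℝ :=
  hazard (densEst K₁ b T n ω) t

/-- The conditional hazard rate estimator `ĥₙ(t | τ) = f̂ₙ(t | τ) / Ŝₙ(t | τ)`, where
`f̂ₙ(t | τ) = f̂ₙ(τ, t) / f̂ₙ(τ)`. -/
def condHazardEst {Ω : Type*} (K₁ K₂ : ℝ → ℝ) (b : ℕ → ℝ) (T : ℕ → Ω → ℝ) (n : ℕ) (ω : Ω)
    (τ t : ℝ) : ℝ :=
  hazard (condDensity (densEst K₁ b T n ω) (jointDensEst K₁ K₂ b T n ω) τ) t

end

/-! Up to normalisation both density estimators are additive functionals `∑ Φ (T i, T (i + 1))` of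
the chain, with `Φ` a product of rescaled kernels. They split into a fluctuation around conditional
means and an ergodic average of these means.

Fluctuation. Subtracting from each term the mean of `Φ` under the two-step transition from `T i`
leaves two sums of bounded martingale differences and a bounded telescoping term
(`abs_twoStepDev_le`). By Azuma–Hoeffding a sum exceeds `ε n bₙ²` with probability at most `2 exp
(-2 ε² n bₙ⁴ / C²)`. As `n bₙ⁴ / ln n → ∞`, this is eventually below any power of `n`, so
Borel–Cantelli covers a grid of order `n²` points `(τ, t)`. Kernels of bounded variation are
differences of monotone functions, and monotone functionals are sandwiched between grid points. The
transition densities are at most `2`, which makes the change of the compensators across a cell of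
order `1 / n` (`HasTransition.ae_eventually_twoStepDev_le`).

Conditional means. Divided by the power of `bₙ`, they are kernel smoothings of the transition
densities, which share one Lipschitz constant. Smoothing therefore moves them by a uniformly small
amount and preserves that constant. The ergodic theorem at frozen bandwidths gives convergence at
each point, and equicontinuity makes it uniform on compact sets
(`IsErgodicSeq.ae_tendstoUniformlyOn_average_smooth`). Stationarity identifies the limits as `f` and
`f₂`.

Finally, hazard rates are obtained by quotients and integrals over bounded intervals, which preserve
uniform convergence on compact sets as long as the limiting denominators do not vanish. -/

/-! ### The pointwise ergodic theorem for bounded functions -/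

section Birkhoff

variable {α : Type*} {S : α → α} {φ : α → ℝ}

/-- The running maximum of the nonempty Birkhoff sums of `φ`, defined recursively. -/
noncomputable def birkhoffMax (S : α → α) (φ : α → ℝ) : ℕ → α → ℝ
  | 0 => φ
  | n + 1 => fun x => φ x + max 0 (birkhoffMax S φ n (S x))

lemma birkhoffMax_succ (n : ℕ) (x : α) :
    birkhoffMax S φ (n + 1) x = φ x + max 0 (birkhoffMax S φ n (S x)) := rfl

lemma measurable_birkhoffMax [MeasurableSpace α] (hS : Measurable S) (hφ : Measurable φ) (n : ℕ) :
    Measurable (birkhoffMax S φ n) := by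
  induction n with
  | zero => exact hφ
  | succ n ih => exact hφ.add (measurable_const.max (ih.comp hS))

lemma birkhoffSum_le_birkhoffMax (n : ℕ) (x : α) :
    birkhoffSum S φ (n + 1) x ≤ birkhoffMax S φ n x := by
  induction n generalizing x with
  | zero => simp [birkhoffMax]
  | succ n ih =>
    rw [birkhoffSum_succ', birkhoffMax_succ]
    linarith [ih (S x), le_max_right 0 (birkhoffMax S φ n (S x))]

lemma le_birkhoffMax (n : ℕ) (x : α) : φ x ≤ birkhoffMax S φ n x := by
  cases n with
  | zero => exact le_rfl
  | succ n => rw [birkhoffMax_succ]; linarith [le_max_left 0 (birkhoffMax S φ n (S x))]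

lemma birkhoffMax_le_succ (n : ℕ) (x : α) :
    birkhoffMax S φ n x ≤ birkhoffMax S φ (n + 1) x := by
  induction n generalizing x with
  | zero => exact le_birkhoffMax 1 x
  | succ n ih =>
    rw [birkhoffMax_succ, birkhoffMax_succ]
    gcongr
    exact ih (S x)

lemma abs_birkhoffMax_le {C : ℝ} (hC : ∀ x, |φ x| ≤ C) (n : ℕ) (x : α) :
    |birkhoffMax S φ n x| ≤ (n + 1) * C := by
  have hC0 : 0 ≤ C := (abs_nonneg _).trans (hC x)
  induction n generalizing x with
  | zero => simpa [birkhoffMax] using hC x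
  | succ n ih =>
    rw [birkhoffMax_succ]
    have h1 := abs_le.1 (ih (S x))
    have h2 := abs_le.1 (hC x)
    push_cast
    refine abs_le.2 ⟨?_, ?_⟩
    · nlinarith [le_max_left 0 (birkhoffMax S φ n (S x)), Nat.cast_nonneg (α := ℝ) n]
    · have : max 0 (birkhoffMax S φ n (S x)) ≤ (n + 1) * C := max_le (by positivity) h1.2
      linarith

/-- If `φ` has negative mean, its Birkhoff sums are almost surely bounded above. -/
lemma ae_bddAbove_birkhoffSum [MeasurableSpace α] {μ : Measure α} [IsProbabilityMeasure μ] (hS : Ergodic S μ)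
    (hφ : Measurable φ) {C : ℝ} (hC : ∀ x, |φ x| ≤ C) (hneg : ∫ x, φ x ∂μ < 0) :
    ∀ᵐ x ∂μ, ∃ B : ℝ, ∀ n, birkhoffSum S φ (n + 1) x ≤ B := by
  have hSm : Measurable S := hS.toMeasurePreserving.measurable
  have hM : ∀ n, Measurable (birkhoffMax S φ n) := measurable_birkhoffMax hSm hφ
  set E : Set α := {x | ∀ B : ℕ, ∃ n, (B : ℝ) < birkhoffMax S φ n x} with hE
  have hEm : MeasurableSet E := by
    have : E = ⋂ B : ℕ, ⋃ n, {x | (B : ℝ) < birkhoffMax S φ n x} := by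
      ext x; simp [hE]
    rw [this]
    exact MeasurableSet.iInter fun B => MeasurableSet.iUnion fun n =>
      measurableSet_lt measurable_const (hM n)
  -- Passing from `S x` to `x` changes a large maximum by `φ x` only, hence by at most `C`; raising
  -- the level by some `k > C` absorbs this.
  have hEinv : S ⁻¹' E = E := by
    ext x
    have hx := abs_le.1 (hC x)
    constructor
    · intro h B
      obtain ⟨k, hk⟩ := exists_nat_gt C
      obtain ⟨n, hn⟩ := h (B + k)
      refine ⟨n + 1, ?_⟩
      rw [birkhoffMax_succ]
      push_cast at hn
      linarith [le_max_right 0 (birkhoffMax S φ n (S x))]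
    · intro h B
      obtain ⟨k, hk⟩ := exists_nat_gt C
      obtain ⟨n, hn⟩ := h (B + k)
      have hn' := hn.trans_le (birkhoffMax_le_succ n x)
      refine ⟨n, ?_⟩
      rw [birkhoffMax_succ] at hn'
      push_cast at hn'
      by_contra hcon
      have : max 0 (birkhoffMax S φ n (S x)) ≤ B := max_le (by positivity) (not_lt.1 hcon)
      linarith
  have hint : ∀ n, Integrable (birkhoffMax S φ n) μ := fun n =>
    Integrable.of_bound (hM n).aestronglyMeasurable ((n + 1) * C)
      (ae_of_all _ fun x => by simpa using abs_birkhoffMax_le hC n x)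
  rcases hS.toPreErgodic.ae_empty_or_univ hEm hEinv with h0 | h1
  · have : ∀ᵐ x ∂μ, x ∉ E := by
      filter_upwards [h0] with x hx hxE
      exact (hx.mp hxE : x ∈ (∅ : Set α))
    filter_upwards [this] with x hx
    simp only [hE, mem_ofPred_eq, not_forall, not_exists, not_lt] at hx
    obtain ⟨B, hB⟩ := hx
    exact ⟨B, fun n => (birkhoffSum_le_birkhoffMax n x).trans (hB n)⟩
  -- The difference of `birkhoffMax (n + 1)` at `x` and `birkhoffMax n` at `S x` is `φ x - min 0
  -- (birkhoffMax n (S x))`. On `E` it is eventually `φ x`, while its integral is nonnegative by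
  -- invariance and monotonicity in `n`. Hence `φ` would have nonnegative mean.
  · exfalso
    have hae : ∀ᵐ x ∂μ, S x ∈ E := by
      filter_upwards [h1] with x hx
      have : x ∈ E := hx.mpr (mem_univ x)
      rwa [← hEinv] at this
    have hlim : Tendsto (fun n => ∫ x, (birkhoffMax S φ (n + 1) x - birkhoffMax S φ n (S x)) ∂μ)
        atTop (𝓝 (∫ x, φ x ∂μ)) := by
      refine tendsto_integral_of_dominated_convergence (fun _ => 2 * C) ?_
        (integrable_const _) ?_ ?_
      · exact fun n => ((hM (n + 1)).sub ((hM n).comp hSm)).aestronglyMeasurable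
      · refine fun n => ae_of_all _ fun x => ?_
        rw [birkhoffMax_succ, Real.norm_eq_abs]
        have h1 := abs_le.1 (hC x)
        have h2 := abs_le.1 (hC (S x))
        have h3 : φ (S x) ≤ birkhoffMax S φ n (S x) := le_birkhoffMax n (S x)
        rcases le_total 0 (birkhoffMax S φ n (S x)) with h | h
        · rw [max_eq_right h]; exact abs_le.2 ⟨by linarith, by linarith⟩
        · rw [max_eq_left h]; exact abs_le.2 ⟨by linarith, by linarith⟩
      · filter_upwards [hae] with x hx
        obtain ⟨n, hn⟩ := hx 0
        refine tendsto_const_nhds.congr' ?_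
        filter_upwards [eventually_ge_atTop n] with m hm
        have : birkhoffMax S φ n (S x) ≤ birkhoffMax S φ m (S x) :=
          monotone_nat_of_le_succ (fun k => birkhoffMax_le_succ k (S x)) hm
        have h0 : 0 ≤ birkhoffMax S φ m (S x) := by
          push_cast at hn; linarith
        rw [birkhoffMax_succ, max_eq_right h0]; ring
    refine absurd (ge_of_tendsto' hlim fun n => ?_) (not_le.2 hneg)
    have hcomp : Integrable (fun x => birkhoffMax S φ n (S x)) μ :=
      hS.toMeasurePreserving.integrable_comp_of_integrable (hint n)
    have heq : ∫ x, birkhoffMax S φ n (S x) ∂μ = ∫ x, birkhoffMax S φ n x ∂μ := by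
      conv_rhs => rw [← hS.toMeasurePreserving.map_eq]
      rw [integral_map hSm.aemeasurable (hM n).aestronglyMeasurable]
    rw [integral_sub (hint _) hcomp, heq, sub_nonneg]
    exact integral_mono (hint _) (hint _) fun x => birkhoffMax_le_succ n x

/-- The function `φ - m - ε / 2` has mean `-ε / 2 < 0`, so its sums are bounded by some `B`; the
other `ε / 2` per term absorbs `B` for large `n`. -/
lemma ae_eventually_birkhoffSum_le [MeasurableSpace α] {μ : Measure α} [IsProbabilityMeasure μ] (hS : Ergodic S μ)
    (hφ : Measurable φ) {C : ℝ} (hC : ∀ x, |φ x| ≤ C) {ε : ℝ} (hε : 0 < ε) :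
    ∀ᵐ x ∂μ, ∀ᶠ n : ℕ in atTop, birkhoffSum S φ n x ≤ n * (∫ y, φ y ∂μ + ε) := by
  set m := ∫ y, φ y ∂μ
  have hφi : Integrable φ μ := Integrable.of_bound hφ.aestronglyMeasurable C
    (ae_of_all _ fun x => by simpa using hC x)
  have key := ae_bddAbove_birkhoffSum (φ := fun x => φ x - (m + ε / 2)) (C := C + |m + ε / 2|) hS
    (hφ.sub_const _) (fun x => (abs_sub _ _).trans (by gcongr; exact hC x))
    (by rw [integral_sub hφi (integrable_const _)]; simp; linarith)
  filter_upwards [key] with x ⟨B, hB⟩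
  obtain ⟨N, hN⟩ := exists_nat_gt (B / (ε / 2))
  filter_upwards [eventually_ge_atTop (max N 1)] with n hn
  obtain ⟨k, rfl⟩ : ∃ k, n = k + 1 := ⟨n - 1, by have := (le_max_right N 1).trans hn; omega⟩
  have h := hB k
  have hsum : birkhoffSum S (fun x => φ x - (m + ε / 2)) (k + 1) x
      = birkhoffSum S φ (k + 1) x - (k + 1 : ℕ) * (m + ε / 2) := by
    simp [birkhoffSum, Finset.sum_sub_distrib]; ring
  rw [hsum] at h
  have hN' : (N : ℝ) ≤ (k + 1 : ℕ) := by exact_mod_cast (le_max_left N 1).trans hn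
  have : B < (k + 1 : ℕ) * (ε / 2) := by
    rw [div_lt_iff₀ (by positivity)] at hN
    nlinarith
  nlinarith

/-- **Birkhoff's pointwise ergodic theorem** for bounded measurable functions. -/
theorem ae_tendsto_birkhoffSum_div [MeasurableSpace α] {μ : Measure α} [IsProbabilityMeasure μ] (hS : Ergodic S μ)
    (hφ : Measurable φ) {C : ℝ} (hC : ∀ x, |φ x| ≤ C) :
    ∀ᵐ x ∂μ, Tendsto (fun n : ℕ => birkhoffSum S φ n x / n) atTop (𝓝 (∫ y, φ y ∂μ)) := by
  have h1 : ∀ᵐ x ∂μ, ∀ k : ℕ, ∀ᶠ n : ℕ in atTop,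
      birkhoffSum S φ n x ≤ n * (∫ y, φ y ∂μ + 1 / (k + 1 : ℝ)) :=
    ae_all_iff.2 fun k => ae_eventually_birkhoffSum_le hS hφ hC (by positivity)
  have h2 : ∀ᵐ x ∂μ, ∀ k : ℕ, ∀ᶠ n : ℕ in atTop,
      birkhoffSum S (fun y => -φ y) n x ≤ n * (∫ y, -φ y ∂μ + 1 / (k + 1 : ℝ)) :=
    ae_all_iff.2 fun k => ae_eventually_birkhoffSum_le hS hφ.neg
      (fun x => by rw [Pi.neg_apply, abs_neg]; exact hC x) (by positivity)
  filter_upwards [h1, h2] with x h1 h2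
  rw [Metric.tendsto_atTop']
  intro ε hε
  obtain ⟨k, hk⟩ := exists_nat_one_div_lt hε
  obtain ⟨N, hN⟩ := eventually_atTop.1 ((h1 k).and ((h2 k).and (eventually_ge_atTop 1)))
  refine ⟨N, fun n hn => ?_⟩
  obtain ⟨ha, hb, hn1⟩ := hN n hn.le
  have hsum : birkhoffSum S (fun y => -φ y) n x = - birkhoffSum S φ n x := by
    simp [birkhoffSum]
  rw [hsum, integral_neg] at hb
  have hn0 : (0 : ℝ) < n := by exact_mod_cast hn1
  rw [Real.dist_eq, abs_lt]
  constructor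
  · have : ∫ y, φ y ∂μ - 1 / (k + 1 : ℝ) ≤ birkhoffSum S φ n x / n := by
      rw [le_div_iff₀ hn0]; nlinarith
    linarith
  · have : birkhoffSum S φ n x / n ≤ ∫ y, φ y ∂μ + 1 / (k + 1 : ℝ) := by
      rw [div_le_iff₀ hn0]; nlinarith
    linarith

end Birkhoff

/-! ### Stationary Markov sequences and their transition kernel -/

section Markov

variable {Ω : Type*} [MeasurableSpace Ω] {μ : Measure Ω} {T : ℕ → Ω → ℝ}

lemma measurable_past (hT : ∀ i, Measurable (T i)) (n : ℕ) : Measurable (past T n) :=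
  measurable_pi_lambda _ fun j => hT j

lemma seqShift_iterate (n : ℕ) (x : ℕ → ℝ) : seqShift^[n] x = fun i => x (i + n) := by
  induction n generalizing x with
  | zero => rfl
  | succ n ih =>
    rw [Function.iterate_succ_apply, ih]
    funext i
    simp only [seqShift]
    congr 1

lemma IsStationarySeq.map_shift (hstat : IsStationarySeq T μ) (hT : ∀ i, Measurable (T i))
    {β : Type*} [MeasurableSpace β] {F : (ℕ → ℝ) → β} (hF : Measurable F) (n : ℕ) :
    μ.map (fun ω => F fun i => T (i + n) ω) = μ.map (fun ω => F fun i => T i ω) := by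
  have hTm : Measurable (fun ω i => T i ω) := measurable_pi_lambda _ hT
  have h := (hstat.iterate n).map_eq
  have hm := (hstat.iterate n).measurable
  rw [seqLaw, Measure.map_map hm hTm] at h
  have h2 := congrArg (Measure.map F) h
  rw [Measure.map_map hF (hm.comp hTm), Measure.map_map hF hTm] at h2
  refine Eq.trans ?_ h2
  congr 1
  funext ω
  simp [seqShift_iterate]

lemma IsStationarySeq.map_eq (hstat : IsStationarySeq T μ) (hT : ∀ i, Measurable (T i)) (n : ℕ) :
    μ.map (T n) = μ.map (T 0) := by
  simpa using hstat.map_shift hT (measurable_pi_apply 0) n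

lemma IsStationarySeq.map_pair_eq (hstat : IsStationarySeq T μ) (hT : ∀ i, Measurable (T i))
    (n : ℕ) : μ.map (fun ω => (T n ω, T (n + 1) ω)) = μ.map (fun ω => (T 0 ω, T 1 ω)) := by
  simpa [add_comm] using
    hstat.map_shift hT ((measurable_pi_apply 0).prodMk (measurable_pi_apply 1)) n

/-- `κ` is a transition kernel of the sequence `T`: the law of `T (n + 1)` given the past is
`κ (T n)`. -/
def HasTransition (T : ℕ → Ω → ℝ) (μ : Measure Ω) (κ : Kernel ℝ ℝ) : Prop :=
  ∀ n, ∀ F : (Fin (n + 1) → ℝ) → ℝ → ℝ≥0∞, Measurable (Function.uncurry F) →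
    ∫⁻ ω, F (past T n ω) (T (n + 1) ω) ∂μ = ∫⁻ ω, ∫⁻ y, F (past T n ω) y ∂κ (T n ω) ∂μ

variable [IsProbabilityMeasure μ]

/-- The Markov property reduces the conditional law given the past to the one given `T n`, and
stationarity of the pairs makes the latter independent of `n`. -/
lemma IsMarkovSeq.hasTransition (hmarkov : IsMarkovSeq T μ) (hstat : IsStationarySeq T μ)
    (hT : ∀ i, Measurable (T i)) : HasTransition T μ (condDistrib (T 1) (T 0) μ) := by
  intro n F hF
  set κ := condDistrib (T 1) (T 0) μ
  have hp := measurable_past hT n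
  have hlast : Measurable (fun x : Fin (n + 1) → ℝ => x (Fin.last n)) := measurable_pi_apply _
  have hκ : condDistrib (T (n + 1)) (T n) μ =ᵐ[μ.map (T n)] κ := by
    refine condDistrib_ae_eq_of_measure_eq_compProd _ (hT _).aemeasurable ?_
    rw [hstat.map_pair_eq hT n, hstat.map_eq hT n, compProd_map_condDistrib (hT 1).aemeasurable]
  have hκ' : ∀ᵐ ω ∂μ, condDistrib (T (n + 1)) (T n) μ (T n ω) = κ (T n ω) :=
    ae_of_ae_map (hT n).aemeasurable hκ
  -- Two probability measures on a product agree once they agree on rectangles, and there the claim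
  -- is the defining property of the conditional expectation.
  have key : μ.map (fun ω => (past T n ω, T (n + 1) ω))
      = (μ.map (past T n)) ⊗ₘ (κ.comap (fun x => x (Fin.last n)) hlast) := by
    have := Measure.isProbabilityMeasure_map (μ := μ) (hp.prodMk (hT (n + 1))).aemeasurable
    have := Measure.isProbabilityMeasure_map (μ := μ) hp.aemeasurable
    refine Measure.ext_prod fun {s t} hs ht => ?_
    rw [Measure.compProd_apply_prod hs ht, Measure.map_apply (hp.prodMk (hT _)) (hs.prod ht),
      setLIntegral_map hs (Kernel.measurable_coe _ ht) hp]
    have hset : (fun ω => (past T n ω, T (n + 1) ω)) ⁻¹' s ×ˢ t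
        = T (n + 1) ⁻¹' t ∩ past T n ⁻¹' s := by
      ext ω; simp [and_comm]
    have hAs : MeasurableSet[MeasurableSpace.comap (past T n) inferInstance] (past T n ⁻¹' s) :=
      ⟨s, hs, rfl⟩
    have h1 : ∫ ω in past T n ⁻¹' s, (κ (T n ω)).real t ∂μ
        = μ.real (T (n + 1) ⁻¹' t ∩ past T n ⁻¹' s) := by
      have e1 : μ⟦T (n + 1) ⁻¹' t | MeasurableSpace.comap (past T n) inferInstance⟧
          =ᵐ[μ] fun ω => (κ (T n ω)).real t := by
        refine (hmarkov n t ht).trans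
          ((condDistrib_ae_eq_condExp (hT n) (hT (n + 1)) ht).symm.trans ?_)
        filter_upwards [hκ'] with ω hω
        rw [hω]
      rw [← integral_congr_ae (ae_restrict_of_ae e1),
        setIntegral_condExp hp.comap_le ((integrable_const _).indicator (hT _ ht)) hAs,
        integral_indicator (hT _ ht), setIntegral_const, measureReal_restrict_apply (hT _ ht)]
      simp
    rw [hset, ← ofReal_measureReal, ← h1, ofReal_integral_eq_lintegral_ofReal]
    · refine lintegral_congr fun ω => ?_
      rw [ofReal_measureReal]; rfl
    · refine Integrable.of_bound (C := 1) ?_ (ae_of_all _ fun ω => ?_)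
      · exact (((Kernel.measurable_coe κ ht).comp (hT n)).ennreal_toReal).aestronglyMeasurable
      · rw [Real.norm_eq_abs, abs_of_nonneg measureReal_nonneg]
        exact measureReal_le_one
    · exact ae_of_all _ fun ω => measureReal_nonneg
  have h := lintegral_map hF (hp.prodMk (hT (n + 1))) (μ := μ)
  rw [key, Measure.lintegral_compProd hF, lintegral_map _ hp] at h
  · exact h.symm
  · exact hF.lintegral_kernel_prod_right'

/-- The transition kernel over two steps, as the law of the next two values. -/
noncomputable def twoStep (κ : Kernel ℝ ℝ) : Kernel ℝ (ℝ × ℝ) := κ ⊗ₖ (Kernel.prodMkLeft ℝ κ)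

instance (κ : Kernel ℝ ℝ) [IsMarkovKernel κ] : IsMarkovKernel (twoStep κ) := by
  unfold twoStep; infer_instance

lemma lintegral_twoStep (κ : Kernel ℝ ℝ) [IsMarkovKernel κ] (x : ℝ) {F : ℝ × ℝ → ℝ≥0∞}
    (hF : Measurable F) :
    ∫⁻ q, F q ∂(twoStep κ x) = ∫⁻ y, ∫⁻ z, F (y, z) ∂κ y ∂κ x := by
  rw [twoStep, Kernel.lintegral_compProd _ _ _ hF]
  simp only [Kernel.prodMkLeft_apply]

lemma integral_twoStep (κ : Kernel ℝ ℝ) [IsMarkovKernel κ] (x : ℝ) {F : ℝ × ℝ → ℝ}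
    (hF : Integrable F (twoStep κ x)) :
    ∫ q, F q ∂(twoStep κ x) = ∫ y, ∫ z, F (y, z) ∂κ y ∂κ x := by
  rw [twoStep, integral_compProd hF]
  simp only [Kernel.prodMkLeft_apply]

/-- Uniqueness of disintegrations. It carries regularity assumed of the conditional law given `past
T 0`, a vector of length one, over to `κ`. -/
lemma HasTransition.condDistrib_eq {κ : Kernel ℝ ℝ} [IsMarkovKernel κ] (hκ : HasTransition T μ κ)
    (hT : ∀ i, Measurable (T i)) :
    ∀ᵐ x ∂(μ.map (past T 0)), condDistrib (T 1) (past T 0) μ x = κ (x 0) := by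
  have hp := measurable_past hT 0
  refine condDistrib_ae_eq_of_measure_eq_compProd
    (κ := κ.comap (fun x : Fin 1 → ℝ => x 0) (measurable_pi_apply 0)) _ (hT 1).aemeasurable ?_
  refine Measure.ext fun s hs => ?_
  have h1 := lintegral_map (μ := μ) (measurable_one.indicator hs) (hp.prodMk (hT 1))
  have h2 := hκ 0 (fun x y => s.indicator 1 (x, y)) (measurable_one.indicator hs)
  rw [lintegral_indicator_one hs] at h1
  rw [← lintegral_indicator_one (μ := _ ⊗ₘ _) hs,
    Measure.lintegral_compProd (measurable_one.indicator hs), lintegral_map _ hp]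
  · exact h1.trans h2
  · exact (measurable_one.indicator hs).lintegral_kernel_prod_right'

/-- The transition property at time `1` integrates out `T 2`, then at time `0` it integrates out `T
1`; uniqueness of disintegrations concludes. -/
lemma HasTransition.condDistrib_twoStep_eq {κ : Kernel ℝ ℝ} [IsMarkovKernel κ]
    (hκ : HasTransition T μ κ) (hT : ∀ i, Measurable (T i)) :
    ∀ᵐ x ∂(μ.map (past T 0)),
      condDistrib (fun ω => (T 1 ω, T 2 ω)) (past T 0) μ x = twoStep κ (x 0) := by
  have hp := measurable_past hT 0
  refine condDistrib_ae_eq_of_measure_eq_compProd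
    (κ := (twoStep κ).comap (fun x : Fin 1 → ℝ => x 0) (measurable_pi_apply 0)) _
    ((hT 1).prodMk (hT 2)).aemeasurable ?_
  refine Measure.ext fun s hs => ?_
  have hind : Measurable (s.indicator (1 : (Fin 1 → ℝ) × ℝ × ℝ → ℝ≥0∞)) :=
    measurable_one.indicator hs
  have h1 := lintegral_map (μ := μ) hind (hp.prodMk ((hT 1).prodMk (hT 2)))
  have h2 := hκ 1 (fun x y => s.indicator 1 ((fun _ => x 0 : Fin 1 → ℝ), (x 1, y)))
    (hind.comp (by fun_prop))
  have h3 := hκ 0 (fun x y => ∫⁻ z, s.indicator 1 ((fun _ => x 0 : Fin 1 → ℝ), (y, z)) ∂κ y) (by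
    have := Measurable.lintegral_kernel_prod_right'
      (κ := κ.comap (fun p : (Fin 1 → ℝ) × ℝ => p.2) measurable_snd)
      (f := fun q : ((Fin 1 → ℝ) × ℝ) × ℝ => 
        s.indicator (1 : (Fin 1 → ℝ) × ℝ × ℝ → ℝ≥0∞) ((fun _ => q.1.1 0), (q.1.2, q.2)))
      (hind.comp (by fun_prop))
    exact this)
  have hpast : ∀ ω, (fun _ => T 0 ω : Fin 1 → ℝ) = past T 0 ω := by
    intro ω; funext j; fin_cases j; rfl
  rw [lintegral_indicator_one hs] at h1
  rw [← lintegral_indicator_one (μ := _ ⊗ₘ _) hs, Measure.lintegral_compProd hind,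
    lintegral_map _ hp, h1]
  · have e1 : ∫⁻ ω, s.indicator 1 (past T 0 ω, T 1 ω, T 2 ω) ∂μ
        = ∫⁻ ω, ∫⁻ y, s.indicator 1 ((fun _ => T 0 ω : Fin 1 → ℝ), (T 1 ω, y)) ∂κ (T 1 ω) ∂μ := by
      simp_rw [← hpast]; exact h2
    refine e1.trans (h3.trans (lintegral_congr fun ω => ?_))
    rw [Kernel.comap_apply, lintegral_twoStep κ (past T 0 ω 0)
      (F := fun q => s.indicator 1 (past T 0 ω, q)) (hind.comp measurable_prodMk_left)]
    have : (fun _ => past T 0 ω 0 : Fin 1 → ℝ) = past T 0 ω := hpast ω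
    rw [this]; rfl
  · exact hind.lintegral_kernel_prod_right'

end Markov

/-! ### The Azuma–Hoeffding inequality for Markov sequences -/

section Azuma

/-- The deviation of `Φ x y` from its mean under `y ∼ κ x`. -/
noncomputable def kernelDev (κ : Kernel ℝ ℝ) (Φ : ℝ × ℝ → ℝ) (x y : ℝ) : ℝ :=
  Φ (x, y) - ∫ z, Φ (x, z) ∂κ x

lemma measurable_kernelDev (κ : Kernel ℝ ℝ) [IsMarkovKernel κ] {Φ : ℝ × ℝ → ℝ}
    (hΦ : Measurable Φ) : Measurable (Function.uncurry (kernelDev κ Φ)) := by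
  have h : Measurable fun x => ∫ z, Φ (x, z) ∂κ x :=
    (hΦ.stronglyMeasurable.integral_kernel_prod_right').measurable
  exact hΦ.sub (h.comp measurable_fst)

lemma Measurable.kernelDev {α : Type*} [MeasurableSpace α] {u v : α → ℝ} (hu : Measurable u)
    (hv : Measurable v) (κ : Kernel ℝ ℝ) [IsMarkovKernel κ] {Φ : ℝ × ℝ → ℝ} (hΦ : Measurable Φ) :
    Measurable fun a => kernelDev κ Φ (u a) (v a) :=
  (measurable_kernelDev κ hΦ).comp (hu.prodMk hv)

/-- Hoeffding's lemma: a variable with values in an interval of length `C` is sub-Gaussian with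
variance proxy `(C / 2) ^ 2`. -/
lemma lintegral_exp_kernelDev_le (κ : Kernel ℝ ℝ) [IsMarkovKernel κ] {Φ : ℝ × ℝ → ℝ}
    (hΦ : Measurable Φ) {C : ℝ} (hΦC : ∀ p, Φ p ∈ Icc 0 C) (l x : ℝ) :
    ∫⁻ y, ENNReal.ofReal (Real.exp (l * kernelDev κ Φ x y)) ∂κ x
      ≤ ENNReal.ofReal (Real.exp (l ^ 2 * C ^ 2 / 8)) := by
  have h := hasSubgaussianMGF_of_mem_Icc (μ := κ x) (X := fun y => Φ (x, y)) (a := 0) (b := C)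
    (hΦ.comp measurable_prodMk_left).aemeasurable (ae_of_all _ fun y => hΦC (x, y))
  have h1 := h.mgf_le l
  simp only [kernelDev]
  rw [← ofReal_integral_eq_lintegral_ofReal (h.integrable_exp_mul l)
    (ae_of_all _ fun y => (Real.exp_pos _).le)]
  refine ENNReal.ofReal_le_ofReal (h1.trans_eq ?_)
  congr 1
  simp only [sub_zero, NNReal.coe_pow, NNReal.coe_div, coe_nnnorm, Real.norm_eq_abs,
    NNReal.coe_ofNat, div_pow, sq_abs]
  ring

variable {Ω : Type*} [MeasurableSpace Ω] {μ : Measure Ω} [IsProbabilityMeasure μ]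
  {T : ℕ → Ω → ℝ} {κ : Kernel ℝ ℝ} [IsMarkovKernel κ]

/-- All terms but the last are a function `W` of the past. Conditioning on it, the last term
contributes a factor of at most `exp (l² C² / 8)`. -/
lemma HasTransition.lintegral_exp_sum_le (hκ : HasTransition T μ κ)
    {Φ : ℝ × ℝ → ℝ} (hΦ : Measurable Φ) {C : ℝ} (hΦC : ∀ p, Φ p ∈ Icc 0 C) (l : ℝ) (n : ℕ) :
    ∫⁻ ω, ENNReal.ofReal
        (Real.exp (l * ∑ i ∈ Finset.range n, kernelDev κ Φ (T i ω) (T (i + 1) ω))) ∂μ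
      ≤ ENNReal.ofReal (Real.exp (n * (l ^ 2 * C ^ 2 / 8))) := by
  induction n with
  | zero => simp
  | succ n ih =>
    set W : (Fin (n + 1) → ℝ) → ℝ := fun x => ∑ i : Fin n, kernelDev κ Φ (x i.castSucc) (x i.succ)
    have hW : Measurable W := Finset.measurable_sum _ fun i _ =>
      (measurable_pi_apply i.castSucc).kernelDev (measurable_pi_apply i.succ) κ hΦ
    have hWsum : ∀ ω, ∑ i ∈ Finset.range n, kernelDev κ Φ (T i ω) (T (i + 1) ω)
        = W (past T n ω) := by
      intro ω
      simp [W, past, Finset.sum_range]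
    have h := hκ n (fun x y => ENNReal.ofReal (Real.exp (l * W x)) *
        ENNReal.ofReal (Real.exp (l * kernelDev κ Φ (x (Fin.last n)) y))) (by
      have h2 : Measurable fun p : (Fin (n + 1) → ℝ) × ℝ =>
          kernelDev κ Φ (p.1 (Fin.last n)) p.2 :=
        ((measurable_pi_apply (Fin.last n)).comp measurable_fst).kernelDev measurable_snd κ hΦ
      have h3 : Measurable fun p : (Fin (n + 1) → ℝ) × ℝ => W p.1 := hW.comp measurable_fst
      exact (h3.const_mul l).exp.ennreal_ofReal.mul (h2.const_mul l).exp.ennreal_ofReal)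
    calc _ = ∫⁻ ω, ENNReal.ofReal (Real.exp (l * W (past T n ω))) *
        ENNReal.ofReal (Real.exp (l * kernelDev κ Φ (T n ω) (T (n + 1) ω))) ∂μ := by
          refine lintegral_congr fun ω => ?_
          rw [Finset.sum_range_succ, mul_add, Real.exp_add,
            ENNReal.ofReal_mul (Real.exp_pos _).le, hWsum]
      _ = ∫⁻ ω, ∫⁻ y, ENNReal.ofReal (Real.exp (l * W (past T n ω))) *
        ENNReal.ofReal (Real.exp (l * kernelDev κ Φ (T n ω) y)) ∂κ (T n ω) ∂μ := h
      _ ≤ ∫⁻ ω, ENNReal.ofReal (Real.exp (l * W (past T n ω))) *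
          ENNReal.ofReal (Real.exp (l ^ 2 * C ^ 2 / 8)) ∂μ := by
          refine lintegral_mono fun ω => ?_
          rw [lintegral_const_mul']
          · gcongr
            exact lintegral_exp_kernelDev_le κ hΦ hΦC l _
          · exact ENNReal.ofReal_ne_top
      _ ≤ ENNReal.ofReal (Real.exp (n * (l ^ 2 * C ^ 2 / 8))) *
          ENNReal.ofReal (Real.exp (l ^ 2 * C ^ 2 / 8)) := by
          rw [lintegral_mul_const' _ _ ENNReal.ofReal_ne_top]
          gcongr
          simpa only [hWsum] using ih
      _ = _ := by
          rw [← ENNReal.ofReal_mul (Real.exp_pos _).le, ← Real.exp_add]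
          congr 2
          push_cast; ring

lemma measurable_sum_kernelDev (hT : ∀ i, Measurable (T i)) {Φ : ℝ × ℝ → ℝ} (hΦ : Measurable Φ)
    (n : ℕ) :
    Measurable fun ω => ∑ i ∈ Finset.range n, kernelDev κ Φ (T i ω) (T (i + 1) ω) :=
  Finset.measurable_sum _ fun i _ => (hT i).kernelDev (hT (i + 1)) κ hΦ

/-- The **Azuma–Hoeffding inequality** for the centered additive functionals of a Markov
sequence. -/
theorem HasTransition.measure_abs_sum_ge_le (hκ : HasTransition T μ κ)
    (hT : ∀ i, Measurable (T i)) {Φ : ℝ × ℝ → ℝ} (hΦ : Measurable Φ) {C : ℝ} (hC : 0 < C)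
    (hΦC : ∀ p, Φ p ∈ Icc 0 C) {n : ℕ} (hn : 0 < n) {r : ℝ} (hr : 0 ≤ r) :
    μ {ω | r ≤ |∑ i ∈ Finset.range n, kernelDev κ Φ (T i ω) (T (i + 1) ω)|}
      ≤ ENNReal.ofReal (2 * Real.exp (-(2 * r ^ 2 / (n * C ^ 2)))) := by
  set Z : Ω → ℝ := fun ω => ∑ i ∈ Finset.range n, kernelDev κ Φ (T i ω) (T (i + 1) ω)
  have hZ : Measurable Z := measurable_sum_kernelDev hT hΦ n
  have hn' : (0 : ℝ) < n := by exact_mod_cast hn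
  -- The minimiser of the Chernoff exponent `n l² C² / 8 - l r`, whose minimum is `-2 r² / (n C²)`.
  set l := 4 * r / (n * C ^ 2)
  have hl : 0 ≤ l := by positivity
  -- The signs `s = 1` and `s = -1` give the two tails.
  have side : ∀ s : ℝ, s ^ 2 = 1 → μ {ω | r ≤ s * Z ω}
      ≤ ENNReal.ofReal (Real.exp (-(2 * r ^ 2 / (n * C ^ 2)))) := by
    intro s hs
    have h1 := hκ.lintegral_exp_sum_le hΦ hΦC (l * s) n
    have h2 := mul_meas_ge_le_lintegral (μ := μ)
      (f := fun ω => ENNReal.ofReal (Real.exp (l * s * Z ω)))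
      ((hZ.const_mul _).exp.ennreal_ofReal) (ENNReal.ofReal (Real.exp (l * r)))
    have h3 : {ω | r ≤ s * Z ω} ⊆ {ω | ENNReal.ofReal (Real.exp (l * r)) ≤
        ENNReal.ofReal (Real.exp (l * s * Z ω))} := by
      intro ω hω
      refine ENNReal.ofReal_le_ofReal (Real.exp_le_exp.2 ?_)
      rw [mul_assoc]
      exact mul_le_mul_of_nonneg_left hω hl
    have h4 : ENNReal.ofReal (Real.exp (l * r)) * μ {ω | r ≤ s * Z ω}
        ≤ ENNReal.ofReal (Real.exp (n * ((l * s) ^ 2 * C ^ 2 / 8))) :=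
      (mul_le_mul_right (measure_mono h3) _).trans (h2.trans h1)
    have h5 : ENNReal.ofReal (Real.exp (-(l * r))) * ENNReal.ofReal (Real.exp (l * r)) = 1 := by
      rw [← ENNReal.ofReal_mul (Real.exp_pos _).le, ← Real.exp_add]; simp
    calc μ {ω | r ≤ s * Z ω}
        = ENNReal.ofReal (Real.exp (-(l * r))) *
          (ENNReal.ofReal (Real.exp (l * r)) * μ {ω | r ≤ s * Z ω}) := by
          rw [← mul_assoc, h5, one_mul]
      _ ≤ ENNReal.ofReal (Real.exp (-(l * r))) *
          ENNReal.ofReal (Real.exp (n * ((l * s) ^ 2 * C ^ 2 / 8))) := by gcongr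
      _ = _ := by
          rw [← ENNReal.ofReal_mul (Real.exp_pos _).le, ← Real.exp_add, mul_pow, hs]
          congr 2
          simp only [l]
          field_simp
          ring
  calc μ {ω | r ≤ |Z ω|} ≤ μ ({ω | r ≤ 1 * Z ω} ∪ {ω | r ≤ (-1) * Z ω}) := by
        refine measure_mono fun ω hω => ?_
        rcases le_abs.1 (show r ≤ |Z ω| from hω) with h | h
        · left; simpa using h
        · right; simpa using h
    _ ≤ _ := (measure_union_le _ _).trans (add_le_add (side 1 (by norm_num)) (side (-1) (by norm_num)))
    _ = _ := by
        rw [← ENNReal.ofReal_add (Real.exp_pos _).le (Real.exp_pos _).le]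
        congr 1; ring

end Azuma

/-! ### Uniform deviations of monotone product functionals -/

section Bracketing

/-- Over `(-n, n]` the integral telescopes to that of `P` over `(n, n + h]` minus that over `(-n, -n
+ h]`. Jumps of `P` do no harm. -/
lemma lintegral_translate_sub_le {P : ℝ → ℝ} (hP : Monotone P) {C : ℝ}
    (hPC : ∀ x, P x ∈ Icc 0 C) {h : ℝ} (hh : 0 ≤ h) :
    ∫⁻ y, ENNReal.ofReal (P (y + h) - P y) ≤ ENNReal.ofReal (h * C) := by
  have hi : ∀ a b : ℝ, IntervalIntegrable P volume a b := fun a b => hP.intervalIntegrable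
  have hP' : Monotone fun y => P (y + h) := fun x y hxy => hP (by linarith)
  have hi' : ∀ a b : ℝ, IntervalIntegrable (fun y => P (y + h)) volume a b :=
    fun a b => hP'.intervalIntegrable
  have hm : Measurable fun y => ENNReal.ofReal (P (y + h) - P y) :=
    (hP'.measurable.sub hP.measurable).ennreal_ofReal
  have hcov : AECover volume atTop fun n : ℕ => Ioc (-(n : ℝ)) n :=
    aecover_Ioc (tendsto_neg_atTop_atBot.comp tendsto_natCast_atTop_atTop)
      tendsto_natCast_atTop_atTop
  refine le_of_tendsto' (hcov.lintegral_tendsto_of_countably_generated hm.aemeasurable) fun n => ?_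
  have hn : -(n : ℝ) ≤ n := by linarith [Nat.cast_nonneg (α := ℝ) n]
  rw [← ofReal_integral_eq_lintegral_ofReal]
  · refine ENNReal.ofReal_le_ofReal ?_
    rw [← intervalIntegral.integral_of_le hn, intervalIntegral.integral_sub (hi' _ _) (hi _ _),
      intervalIntegral.integral_comp_add_right]
    have e1 := intervalIntegral.integral_add_adjacent_intervals (hi (-n) (-n + h)) (hi (-n + h) (n + h))
    have e2 := intervalIntegral.integral_add_adjacent_intervals (hi (-n) n) (hi n (n + h))
    have l1 : 0 ≤ ∫ x in (-n : ℝ)..(-n + h), P x :=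
      intervalIntegral.integral_nonneg (by linarith) fun x _ => (hPC x).1
    have l2 : ∫ x in (n : ℝ)..(n + h), P x ≤ ∫ _ in (n : ℝ)..(n + h), C :=
      intervalIntegral.integral_mono_on (by linarith) (hi _ _) (by simp) fun x _ => (hPC x).2
    simp only [intervalIntegral.integral_const, add_sub_cancel_left, smul_eq_mul] at l2
    linarith
  · exact (intervalIntegrable_iff_integrableOn_Ioc_of_le hn).1 ((hi' _ _).sub (hi _ _))
  · exact ae_of_all _ fun y => sub_nonneg.2 (hP (by linarith))

/-- Rescaling the argument by `b` keeps `F` monotone with the same range, so the bound does not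
depend on `b`. The factor `2` is the bound on the density of `ν`. -/
lemma lintegral_kernel_increment_le {F : ℝ → ℝ} (hF : Monotone F) {C : ℝ}
    (hFC : ∀ x, F x ∈ Icc 0 C) {h b : ℝ} (hh : 0 ≤ h) (hb : 0 < b) (t : ℝ) {ν : Measure ℝ}
    (hν : ν ≤ (2 : ℝ≥0∞) • volume) :
    ∫⁻ y, ENNReal.ofReal (F ((t + h - y) / b) - F ((t - y) / b)) ∂ν
      ≤ ENNReal.ofReal (2 * h * C) := by
  have hP : Monotone fun s => F (s / b) := fun x y hxy => hF (by gcongr)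
  refine (lintegral_mono' hν le_rfl).trans ?_
  rw [lintegral_smul_measure]
  have h1 := lintegral_sub_left_eq_self (μ := (volume : Measure ℝ))
    (fun s => ENNReal.ofReal (F ((s + h) / b) - F (s / b))) t
  have h2 := lintegral_translate_sub_le hP (fun x => hFC _) hh
  have h3 : ∀ y, t + h - y = t - y + h := fun y => by ring
  simp only [h3]
  rw [h1, mul_assoc, ENNReal.ofReal_mul (by norm_num), ENNReal.ofReal_ofNat, smul_eq_mul]
  gcongr

/-- The product kernel function `(x, y) ↦ G((τ - x) / b) H((t - y) / b)`. -/
noncomputable def prodKer (G H : ℝ → ℝ) (b τ t : ℝ) (q : ℝ × ℝ) : ℝ :=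
  G ((τ - q.1) / b) * H ((t - q.2) / b)

variable {G H : ℝ → ℝ} {C : ℝ}

lemma measurable_prodKer (hG : Measurable G) (hH : Measurable H) (b τ t : ℝ) :
    Measurable (prodKer G H b τ t) := by
  unfold prodKer; fun_prop

lemma prodKer_mem (hGC : ∀ x, G x ∈ Icc 0 C) (hHC : ∀ x, H x ∈ Icc 0 C) (b τ t : ℝ) (q : ℝ × ℝ) :
    prodKer G H b τ t q ∈ Icc 0 (C ^ 2) := by
  refine ⟨mul_nonneg (hGC _).1 (hHC _).1, ?_⟩
  rw [sq]
  exact mul_le_mul (hGC _).2 (hHC _).2 (hHC _).1 ((hGC 0).1.trans (hGC 0).2)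

lemma prodKer_mono (hG : Monotone G) (hH : Monotone H) (hGC : ∀ x, G x ∈ Icc 0 C)
    (hHC : ∀ x, H x ∈ Icc 0 C) {b τ t τ' t' : ℝ} (hb : 0 < b) (hτ : τ ≤ τ') (ht : t ≤ t')
    (q : ℝ × ℝ) : prodKer G H b τ t q ≤ prodKer G H b τ' t' q :=
  mul_le_mul (hG (by gcongr)) (hH (by gcongr)) (hHC _).1 (hGC _).1

lemma integrable_of_mem_Icc {α : Type*} [MeasurableSpace α] {ν : Measure α} [IsFiniteMeasure ν]
    {F : α → ℝ} (hF : Measurable F) {A : ℝ} (hFA : ∀ x, F x ∈ Icc 0 A) : Integrable F ν :=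
  Integrable.of_mem_Icc 0 A hF.aemeasurable (ae_of_all _ hFA)

/-- The increment of the product is at most `C` times the sum of the increments of the factors. The
first is integrated against `κ x`, the second against `κ y`, and each contributes at most `2 h C`.
-/
lemma integral_twoStep_prodKer_increment_le {κ : Kernel ℝ ℝ} [IsMarkovKernel κ]
    (hG : Monotone G) (hH : Monotone H) (hGC : ∀ x, G x ∈ Icc 0 C)
    (hHC : ∀ x, H x ∈ Icc 0 C) {b h : ℝ} (hb : 0 < b) (hh : 0 ≤ h) (τ t : ℝ) {x : ℝ}
    (hx : κ x ≤ (2 : ℝ≥0∞) • volume) (hx' : ∀ᵐ y ∂κ x, κ y ≤ (2 : ℝ≥0∞) • volume) :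
    ∫ q, prodKer G H b (τ + h) (t + h) q ∂(twoStep κ x)
      ≤ ∫ q, prodKer G H b τ t q ∂(twoStep κ x) + 4 * h * C ^ 2 := by
  have hC : 0 ≤ C := (hGC 0).1.trans (hGC 0).2
  have hi : ∀ τ t, Integrable (prodKer G H b τ t) (twoStep κ x) := fun τ t =>
    integrable_of_mem_Icc (measurable_prodKer hG.measurable hH.measurable b τ t)
      (prodKer_mem hGC hHC b τ t)
  have hGm := hG.measurable
  have hHm := hH.measurable
  set dG : ℝ → ℝ≥0∞ := fun y => ENNReal.ofReal (G ((τ + h - y) / b) - G ((τ - y) / b))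
  set dH : ℝ → ℝ≥0∞ := fun y => ENNReal.ofReal (H ((t + h - y) / b) - H ((t - y) / b))
  have hdG : Measurable dG := by fun_prop
  have hdH : Measurable dH := by fun_prop
  have key : ∫⁻ q, ENNReal.ofReal (prodKer G H b (τ + h) (t + h) q - prodKer G H b τ t q)
      ∂(twoStep κ x) ≤ ENNReal.ofReal (4 * h * C ^ 2) := by
    calc _ ≤ ∫⁻ q, ENNReal.ofReal C * (dG q.1 + dH q.2) ∂(twoStep κ x) := by
          refine lintegral_mono fun q => ?_
          have g1 : 0 ≤ G ((τ + h - q.1) / b) - G ((τ - q.1) / b) :=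
            sub_nonneg.2 (hG (by gcongr; linarith))
          have g2 : 0 ≤ H ((t + h - q.2) / b) - H ((t - q.2) / b) :=
            sub_nonneg.2 (hH (by gcongr; linarith))
          simp only [dG, dH]
          rw [← ENNReal.ofReal_add g1 g2, ← ENNReal.ofReal_mul hC]
          refine ENNReal.ofReal_le_ofReal ?_
          simp only [prodKer]
          nlinarith [(hGC ((τ - q.1) / b)).2, (hHC ((t + h - q.2) / b)).2]
      _ = ENNReal.ofReal C * (∫⁻ y, dG y ∂κ x + ∫⁻ y, ∫⁻ z, dH z ∂κ y ∂κ x) := by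
          rw [lintegral_const_mul _ (by fun_prop), lintegral_twoStep _ _ (by fun_prop)]
          congr 1
          rw [← lintegral_add_left hdG]
          refine lintegral_congr fun y => ?_
          have : ∫⁻ z, dG y + dH z ∂κ y = dG y + ∫⁻ z, dH z ∂κ y := by
            rw [lintegral_add_left measurable_const]; simp
          exact this
      _ ≤ ENNReal.ofReal C * (ENNReal.ofReal (2 * h * C) + ENNReal.ofReal (2 * h * C)) := by
          gcongr
          · exact lintegral_kernel_increment_le hG hGC hh hb τ hx
          · calc ∫⁻ y, ∫⁻ z, dH z ∂κ y ∂κ x ≤ ∫⁻ y, ENNReal.ofReal (2 * h * C) ∂κ x := by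
                  refine lintegral_mono_ae ?_
                  filter_upwards [hx'] with y hy
                  exact lintegral_kernel_increment_le hH hHC hh hb t hy
              _ = _ := by simp
      _ = _ := by
          rw [← ENNReal.ofReal_add (by positivity) (by positivity), ← ENNReal.ofReal_mul hC]
          congr 1; ring
  have h1 : ∫ q, (prodKer G H b (τ + h) (t + h) q - prodKer G H b τ t q) ∂(twoStep κ x)
      ≤ 4 * h * C ^ 2 := by
    rw [integral_eq_lintegral_of_nonneg_ae]
    · exact ENNReal.toReal_le_of_le_ofReal (by positivity) key
    · exact ae_of_all _ fun q => sub_nonneg.2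
        (prodKer_mono hG hH hGC hHC hb (by linarith) (by linarith) q)
    · exact ((hi _ _).sub (hi _ _)).aestronglyMeasurable
  rw [integral_sub (hi _ _) (hi _ _)] at h1
  linarith

end Bracketing

/-! ### Almost sure uniform bounds for the centered sums: martingale splitting, grid, sandwich. -/

section Deviation

variable {Ω : Type*} {T : ℕ → Ω → ℝ} {κ : Kernel ℝ ℝ} {b : ℕ → ℝ}

/-- Once `b n ≤ 1`, `n bₙ²` dominates `n bₙ⁴`, which eventually exceeds `log n`. Bounded errors are
thus negligible on the scale `n bₙ²`. -/
lemma tendsto_mul_bandwidth_sq (hbpos : ∀ n, 0 < b n) (hb0 : Tendsto b atTop (𝓝 0))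
    (hb : Tendsto (fun n : ℕ => n * b n ^ 4 / Real.log n) atTop atTop) :
    Tendsto (fun n : ℕ => (n : ℝ) * b n ^ 2) atTop atTop := by
  refine tendsto_atTop_mono' _ ?_ (Real.tendsto_log_atTop.comp tendsto_natCast_atTop_atTop)
  filter_upwards [hb.eventually_ge_atTop 1, hb0.eventually_le_const one_pos,
    eventually_ge_atTop 2] with n h1 h2 h3
  have hn2 : (2 : ℝ) ≤ n := by exact_mod_cast h3
  have hlog : 0 < Real.log n := Real.log_pos (by linarith)
  have hbn := hbpos n
  rw [le_div_iff₀ hlog, one_mul] at h1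
  refine h1.trans ?_
  have : b n ^ 4 ≤ b n ^ 2 := pow_le_pow_of_le_one hbn.le h2 (by norm_num)
  gcongr

/-- The sum of the deviations of `Φ (T i, T (i + 1))` from its mean given the past
`T 0, …, T (i - 1)`, with the mean shifted by one index. -/
noncomputable def twoStepDev (κ : Kernel ℝ ℝ) (T : ℕ → Ω → ℝ) (Φ : ℝ × ℝ → ℝ) (n : ℕ) (ω : Ω) : ℝ :=
  ∑ i ∈ Finset.range n, (Φ (T i ω, T (i + 1) ω) - ∫ q, Φ q ∂(twoStep κ (T i ω)))

/-- With `ψ y = ∫ Φ (y, z) κ(y, dz)`, each term is the sum of the martingale differences `Φ (T i, T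
(i + 1)) - ψ (T i)` and `ψ (T (i + 1)) - ∫ ψ dκ(T i)`, plus `ψ (T i) - ψ (T (i + 1))`. The last part
telescopes to at most `C` in absolute value. -/
lemma abs_twoStepDev_le [IsMarkovKernel κ] {Φ : ℝ × ℝ → ℝ} (hΦ : Measurable Φ) {C : ℝ}
    (hΦC : ∀ p, Φ p ∈ Icc 0 C) (n : ℕ) (ω : Ω) :
    |twoStepDev κ T Φ n ω|
      ≤ |∑ i ∈ Finset.range n, kernelDev κ Φ (T i ω) (T (i + 1) ω)|
        + |∑ i ∈ Finset.range n,
            kernelDev κ (fun p => ∫ z, Φ (p.2, z) ∂κ p.2) (T i ω) (T (i + 1) ω)| + C := by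
  set ψ : ℝ → ℝ := fun y => ∫ z, Φ (y, z) ∂κ y
  have hψ : ∀ y, ψ y ∈ Icc 0 C := by
    intro y
    refine ⟨integral_nonneg fun z => (hΦC _).1, ?_⟩
    have := integral_mono (μ := κ y) (integrable_of_mem_Icc (hΦ.comp measurable_prodMk_left)
      fun z => hΦC (y, z)) (integrable_const C) fun z => (hΦC (y, z)).2
    simpa using this
  have hsplit : twoStepDev κ T Φ n ω
      = ∑ i ∈ Finset.range n, kernelDev κ Φ (T i ω) (T (i + 1) ω)
        + ∑ i ∈ Finset.range n, kernelDev κ (fun p => ψ p.2) (T i ω) (T (i + 1) ω)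
        + (ψ (T 0 ω) - ψ (T n ω)) := by
    rw [← Finset.sum_range_sub' (fun i => ψ (T i ω)), ← Finset.sum_add_distrib,
      ← Finset.sum_add_distrib]
    refine Finset.sum_congr rfl fun i _ => ?_
    rw [integral_twoStep _ _ (integrable_of_mem_Icc hΦ hΦC)]
    simp only [kernelDev, ψ]
    ring
  rw [hsplit]
  refine (abs_add_le _ _).trans (add_le_add (abs_add_le _ _) ?_)
  have h0 := hψ (T 0 ω)
  have hn := hψ (T n ω)
  exact abs_le.2 ⟨by linarith [h0.1, hn.2], by linarith [h0.2, hn.1]⟩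

variable [MeasurableSpace Ω] {μ : Measure Ω}

/-- Almost surely, `x = T i` is a point where the one and two step transitions are dominated. -/
lemma HasTransition.ae_forall_dominated (hκ : HasTransition T μ κ) (hT : ∀ i, Measurable (T i))
    (hstat : IsStationarySeq T μ) (hdom : ∀ᵐ x ∂(μ.map (T 0)), κ x ≤ (2 : ℝ≥0∞) • volume) :
    ∀ᵐ ω ∂μ, ∀ i, κ (T i ω) ≤ (2 : ℝ≥0∞) • volume ∧
      ∀ᵐ y ∂κ (T i ω), κ y ≤ (2 : ℝ≥0∞) • volume := by
  obtain ⟨s, hs, hsm, hs0⟩ := exists_measurable_superset_of_null (ae_iff.1 hdom)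
  have hmem : ∀ x, x ∉ s → κ x ≤ (2 : ℝ≥0∞) • volume := fun x hx => by
    by_contra hcon; exact hx (hs hcon)
  have hTi : ∀ i, ∀ᵐ ω ∂μ, T i ω ∉ s := by
    intro i
    rw [← hstat.map_eq hT i] at hs0
    exact ae_of_ae_map (hT i).aemeasurable (measure_eq_zero_iff_ae_notMem.1 hs0)
  refine ae_all_iff.2 fun i => ?_
  -- The next value almost surely avoids the null set `s`, so the transition identity for its
  -- indicator forces `κ (T i) s = 0` almost surely.
  have h1 := hκ i (fun _ y => s.indicator 1 y) ((measurable_one.indicator hsm).comp measurable_snd)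
  have h2 : ∫⁻ ω, s.indicator (1 : ℝ → ℝ≥0∞) (T (i + 1) ω) ∂μ = 0 := by
    refine (lintegral_eq_zero_iff ((measurable_one.indicator hsm).comp (hT _))).2 ?_
    filter_upwards [hTi (i + 1)] with ω hω
    simp [hω]
  rw [h2] at h1
  simp only [lintegral_indicator_one hsm] at h1
  have h3 := (lintegral_eq_zero_iff ((Kernel.measurable_coe κ hsm).comp (hT i))).1 h1.symm
  filter_upwards [hTi i, h3] with ω h4 h5
  refine ⟨hmem _ h4, ?_⟩
  filter_upwards [measure_eq_zero_iff_ae_notMem.1 h5] with y hy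
  exact hmem y hy

variable [IsProbabilityMeasure μ] [IsMarkovKernel κ]

/-- Simultaneous control of polynomially many centered sums. -/
lemma HasTransition.ae_eventually_grid (hκ : HasTransition T μ κ) (hT : ∀ i, Measurable (T i))
    (hbpos : ∀ n, 0 < b n) (hb : Tendsto (fun n : ℕ => n * b n ^ 4 / Real.log n) atTop atTop)
    {Φ : ℕ → ℕ → ℕ → ℝ × ℝ → ℝ} (hΦ : ∀ n j k, Measurable (Φ n j k)) {C : ℝ} (hC : 0 < C)
    (hΦC : ∀ n j k p, Φ n j k p ∈ Icc 0 C) {ε : ℝ} (hε : 0 < ε) :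
    ∀ᵐ ω ∂μ, ∀ᶠ n : ℕ in atTop, ∀ j < n + 2, ∀ k < n + 2,
      |∑ i ∈ Finset.range n, kernelDev κ (Φ n j k) (T i ω) (T (i + 1) ω)| < ε * (n * b n ^ 2) := by
  set s : ℕ → Set Ω := fun n => ⋃ j ∈ Finset.range (n + 2), ⋃ k ∈ Finset.range (n + 2),
    {ω | ε * (n * b n ^ 2) ≤
      |∑ i ∈ Finset.range n, kernelDev κ (Φ n j k) (T i ω) (T (i + 1) ω)|}
  -- This threshold makes the Hoeffding exponent at least `4 log n`. Each probability is then at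
  -- most `2 / n⁴`, and the union over `(n + 2)²` points is summable.
  obtain ⟨N, hN⟩ := eventually_atTop.1
    ((hb.eventually_ge_atTop (2 * C ^ 2 / ε ^ 2)).and (eventually_ge_atTop 2))
  have hs : ∀ n, N ≤ n → μ (s n) ≤ ENNReal.ofReal (32 * (1 / (n : ℝ) ^ 2)) := by
    intro n hn
    obtain ⟨h1, h2⟩ := hN n hn
    have hn2 : (2 : ℝ) ≤ n := by exact_mod_cast h2
    have hlog : 0 < Real.log n := Real.log_pos (by linarith)
    have hbn := hbpos n
    have hexp : 2 * Real.exp (-(2 * (ε * (n * b n ^ 2)) ^ 2 / (n * C ^ 2)))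
        ≤ 2 * (1 / (n : ℝ) ^ 4) := by
      have e1 : Real.exp (-(4 * Real.log n)) = 1 / (n : ℝ) ^ 4 := by
        rw [Real.exp_neg, mul_comm, Real.exp_mul, Real.exp_log (by linarith), one_div]
        norm_cast
      rw [← e1]
      gcongr
      rw [div_le_div_iff₀ (by positivity) hlog] at h1
      rw [le_div_iff₀ (by positivity)]
      calc 4 * Real.log n * (n * C ^ 2) = 2 * n * (2 * C ^ 2 * Real.log n) := by ring
        _ ≤ 2 * n * (n * b n ^ 4 * ε ^ 2) := by gcongr
        _ = _ := by ring
    calc μ (s n) ≤ ∑ j ∈ Finset.range (n + 2), ∑ k ∈ Finset.range (n + 2),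
          ENNReal.ofReal (2 * (1 / (n : ℝ) ^ 4)) := by
          refine (measure_biUnion_finset_le _ _).trans (Finset.sum_le_sum fun j _ =>
            (measure_biUnion_finset_le _ _).trans (Finset.sum_le_sum fun k _ => ?_))
          exact (hκ.measure_abs_sum_ge_le hT (hΦ n j k) hC (hΦC n j k) (by omega)
            (by positivity)).trans (ENNReal.ofReal_le_ofReal hexp)
      _ = ENNReal.ofReal (((n : ℝ) + 2) ^ 2 * (2 * (1 / (n : ℝ) ^ 4))) := by
          simp only [Finset.sum_const, Finset.card_range, nsmul_eq_mul]
          rw [show ((n : ℝ) + 2) ^ 2 * (2 * (1 / (n : ℝ) ^ 4))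
              = ((n + 2 : ℕ) : ℝ) * (((n + 2 : ℕ) : ℝ) * (2 * (1 / (n : ℝ) ^ 4))) by
            push_cast; ring]
          rw [ENNReal.ofReal_mul (Nat.cast_nonneg _), ENNReal.ofReal_mul (Nat.cast_nonneg _),
            ENNReal.ofReal_natCast]
      _ ≤ _ := by
          refine ENNReal.ofReal_le_ofReal ?_
          have : ((n : ℝ) + 2) ^ 2 ≤ 4 * (n : ℝ) ^ 2 := by nlinarith
          calc ((n : ℝ) + 2) ^ 2 * (2 * (1 / (n : ℝ) ^ 4))
              ≤ (4 * (n : ℝ) ^ 2) * (2 * (1 / (n : ℝ) ^ 4)) := by gcongr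
            _ = 8 * (1 / (n : ℝ) ^ 2) := by field_simp; ring
            _ ≤ _ := by gcongr; norm_num
  have hsum : ∑' n, μ (s (n + N)) ≠ ∞ := by
    have hsm : Summable fun n : ℕ => 32 * (1 / ((n + N : ℕ) : ℝ) ^ 2) :=
      ((summable_nat_add_iff N).2 (Real.summable_one_div_nat_pow.2 one_lt_two)).mul_left 32
    exact ne_top_of_le_ne_top hsm.tsum_ofReal_ne_top
      (ENNReal.tsum_le_tsum fun n => hs _ (Nat.le_add_left _ _))
  filter_upwards [ae_eventually_notMem hsum] with ω hω
  obtain ⟨K, hK⟩ := eventually_atTop.1 hω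
  filter_upwards [eventually_ge_atTop (K + N)] with n hn j hj k hk
  have := hK (n - N) (by omega)
  rw [Nat.sub_add_cancel (by omega)] at this
  simp only [s, mem_iUnion, Finset.mem_range, not_exists, mem_ofPred_eq, not_le] at this
  exact this j hj k hk

/-- Uniform almost sure control of the deviations of monotone product functionals. -/
theorem HasTransition.ae_eventually_twoStepDev_le (hκ : HasTransition T μ κ)
    (hT : ∀ i, Measurable (T i)) (hstat : IsStationarySeq T μ)
    (hdom : ∀ᵐ x ∂(μ.map (T 0)), κ x ≤ (2 : ℝ≥0∞) • volume)
    (hbpos : ∀ n, 0 < b n) (hb0 : Tendsto b atTop (𝓝 0))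
    (hb : Tendsto (fun n : ℕ => n * b n ^ 4 / Real.log n) atTop atTop)
    {G H : ℝ → ℝ} (hG : Monotone G) (hH : Monotone H) {C : ℝ} (hC : 0 < C)
    (hGC : ∀ x, G x ∈ Icc 0 C) (hHC : ∀ x, H x ∈ Icc 0 C) {M : ℝ} (hM : 0 < M) :
    ∀ᵐ ω ∂μ, ∀ ε > 0, ∀ᶠ n : ℕ in atTop, ∀ τ ∈ Icc 0 M, ∀ t ∈ Icc 0 M,
      |twoStepDev κ T (prodKer G H (b n) τ t) n ω| ≤ ε * (n * b n ^ 2) := by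
  -- With mesh `M / n` the bracketing error is `4 (M / n) C²` per term, so a constant `4 M C²` over
  -- `n` terms. The lower index of a cell may equal `n` (at the endpoint `M`), so upper corners
  -- reach `n + 1`; this is why indices run below `n + 2`.
  set Φ : ℕ → ℕ → ℕ → ℝ × ℝ → ℝ := fun n j k =>
    prodKer G H (b n) (j * (M / n)) (k * (M / n))
  set Ψ : ℕ → ℕ → ℕ → ℝ × ℝ → ℝ := fun n j k p => ∫ z, Φ n j k (p.2, z) ∂κ p.2
  have hΦm : ∀ n j k, Measurable (Φ n j k) := fun n j k =>
    measurable_prodKer hG.measurable hH.measurable _ _ _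
  have hΦC : ∀ n j k p, Φ n j k p ∈ Icc 0 (C ^ 2) := fun n j k p => prodKer_mem hGC hHC _ _ _ p
  have hΨm : ∀ n j k, Measurable (Ψ n j k) := fun n j k =>
    ((hΦm n j k).stronglyMeasurable.integral_kernel_prod_right' (κ := κ)).measurable.comp
      measurable_snd
  have hΨC : ∀ n j k p, Ψ n j k p ∈ Icc 0 (C ^ 2) := by
    intro n j k p
    refine ⟨integral_nonneg fun z => (hΦC n j k _).1, ?_⟩
    have := integral_mono (μ := κ p.2) (integrable_of_mem_Icc
      ((hΦm n j k).comp measurable_prodMk_left) fun z => hΦC n j k (p.2, z))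
      (integrable_const (C ^ 2)) fun z => (hΦC n j k (p.2, z)).2
    simpa using this
  have A1 : ∀ᵐ ω ∂μ, ∀ m : ℕ, ∀ᶠ n : ℕ in atTop, ∀ j < n + 2, ∀ k < n + 2,
      |∑ i ∈ Finset.range n, kernelDev κ (Φ n j k) (T i ω) (T (i + 1) ω)|
        < 1 / (m + 1 : ℝ) * (n * b n ^ 2) :=
    ae_all_iff.2 fun m => hκ.ae_eventually_grid hT hbpos hb hΦm (by positivity) hΦC (by positivity)
  have A2 : ∀ᵐ ω ∂μ, ∀ m : ℕ, ∀ᶠ n : ℕ in atTop, ∀ j < n + 2, ∀ k < n + 2,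
      |∑ i ∈ Finset.range n, kernelDev κ (Ψ n j k) (T i ω) (T (i + 1) ω)|
        < 1 / (m + 1 : ℝ) * (n * b n ^ 2) :=
    ae_all_iff.2 fun m => hκ.ae_eventually_grid hT hbpos hb hΨm (by positivity) hΨC (by positivity)
  filter_upwards [A1, A2, hκ.ae_forall_dominated hT hstat hdom] with ω h1 h2 h3 ε hε
  obtain ⟨m, hm⟩ := exists_nat_one_div_lt (show 0 < ε / 4 by positivity)
  filter_upwards [h1 m, h2 m, eventually_ge_atTop 1,
    (tendsto_mul_bandwidth_sq hbpos hb0 hb).eventually_ge_atTop ((C ^ 2 + 4 * M * C ^ 2) / (ε / 2))]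
    with n g1 g2 hn hnb τ hτ t ht
  have hn0 : (0 : ℝ) < n := by exact_mod_cast hn
  have hbn := hbpos n
  have hgrid : ∀ j < n + 2, ∀ k < n + 2,
      |twoStepDev κ T (Φ n j k) n ω| ≤ ε / 2 * (n * b n ^ 2) + C ^ 2 := by
    intro j hj k hk
    have := abs_twoStepDev_le (κ := κ) (T := T) (hΦm n j k) (hΦC n j k) n ω
    have e1 := g1 j hj k hk
    have e2 := g2 j hj k hk
    have e3 : 1 / (m + 1 : ℝ) * (n * b n ^ 2) ≤ ε / 4 * (n * b n ^ 2) := by gcongr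
    linarith
  have hcell : ∀ u ∈ Icc 0 M, ∃ j < n + 1, j * (M / n) ≤ u ∧ u ≤ j * (M / n) + M / n := by
    intro u hu
    have hu0 : 0 ≤ u / (M / n) := div_nonneg hu.1 (by positivity)
    refine ⟨⌊u / (M / n)⌋₊, ?_, ?_, ?_⟩
    · refine Nat.lt_succ_of_le (Nat.floor_le_of_le ?_)
      rw [div_le_iff₀ (by positivity)]
      field_simp
      exact hu.2
    · exact (le_div_iff₀ (by positivity)).1 (Nat.floor_le hu0)
    · have := (div_lt_iff₀ (by positivity)).1 (Nat.lt_floor_add_one (u / (M / n)))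
      linarith
  obtain ⟨j, hj, hj1, hj2⟩ := hcell τ hτ
  obtain ⟨k, hk, hk1, hk2⟩ := hcell t ht
  have hhi : Φ n (j + 1) (k + 1)
      = prodKer G H (b n) (j * (M / n) + M / n) (k * (M / n) + M / n) := by
    simp only [Φ]
    congr 1 <;> push_cast <;> ring
  have hle1 : ∀ q, Φ n j k q ≤ prodKer G H (b n) τ t q := fun q =>
    prodKer_mono hG hH hGC hHC hbn hj1 hk1 q
  have hle2 : ∀ q, prodKer G H (b n) τ t q ≤ Φ n (j + 1) (k + 1) q := fun q => by
    rw [hhi]; exact prodKer_mono hG hH hGC hHC hbn hj2 hk2 q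
  have hint : ∀ i, Integrable (prodKer G H (b n) τ t) (twoStep κ (T i ω)) := fun i =>
    integrable_of_mem_Icc (measurable_prodKer hG.measurable hH.measurable _ _ _)
      (prodKer_mem hGC hHC _ _ _)
  have hintΦ : ∀ j k i, Integrable (Φ n j k) (twoStep κ (T i ω)) := fun j k i =>
    integrable_of_mem_Icc (hΦm n j k) (hΦC n j k)
  have hincr : ∀ i, ∫ q, Φ n (j + 1) (k + 1) q ∂(twoStep κ (T i ω))
      ≤ ∫ q, Φ n j k q ∂(twoStep κ (T i ω)) + 4 * (M / n) * C ^ 2 := by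
    intro i
    rw [hhi]
    exact integral_twoStep_prodKer_increment_le hG hH hGC hHC hbn (by positivity) _ _
      (h3 i).1 (h3 i).2
  -- The upper bracket increases the observed part; its compensator exceeds that at `(τ, t)` by no
  -- more than the increment across the cell.
  have hupper : twoStepDev κ T (prodKer G H (b n) τ t) n ω
      ≤ twoStepDev κ T (Φ n (j + 1) (k + 1)) n ω + 4 * M * C ^ 2 := by
    have : 4 * M * C ^ 2 = ∑ i ∈ Finset.range n, 4 * (M / n) * C ^ 2 := by
      simp only [Finset.sum_const, Finset.card_range, nsmul_eq_mul]; field_simp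
    rw [this, twoStepDev, twoStepDev, ← Finset.sum_add_distrib]
    refine Finset.sum_le_sum fun i _ => ?_
    have e1 := hle2 (T i ω, T (i + 1) ω)
    have e2 := integral_mono (hintΦ j k i) (hint i) hle1
    have e3 := hincr i
    linarith
  have hlower : twoStepDev κ T (Φ n j k) n ω
      ≤ twoStepDev κ T (prodKer G H (b n) τ t) n ω + 4 * M * C ^ 2 := by
    have : 4 * M * C ^ 2 = ∑ i ∈ Finset.range n, 4 * (M / n) * C ^ 2 := by
      simp only [Finset.sum_const, Finset.card_range, nsmul_eq_mul]; field_simp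
    rw [this, twoStepDev, twoStepDev, ← Finset.sum_add_distrib]
    refine Finset.sum_le_sum fun i _ => ?_
    have e1 := hle1 (T i ω, T (i + 1) ω)
    have e2 := integral_mono (hint i) (hintΦ (j + 1) (k + 1) i) hle2
    have e3 := hincr i
    linarith
  have b1 := abs_le.1 (hgrid (j + 1) (by omega) (k + 1) (by omega))
  have b2 := abs_le.1 (hgrid j (by omega) k (by omega))
  rw [div_le_iff₀ (by positivity)] at hnb
  exact abs_le.2 ⟨by linarith, by linarith⟩

end Deviation

/-! ### Kernel smoothing of measures with Lipschitz densities -/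

section Kernel

variable {E : Type*} [MeasureSpace E] {K : E → ℝ} {A : ℝ}

/-- A kernel of integral one on `E`, which is bounded by `A`. -/
structure IsBddKernel (K : E → ℝ) (A : ℝ) : Prop where
  measurable : Measurable K
  nonneg : ∀ p, 0 ≤ K p
  le : ∀ p, K p ≤ A
  integrable : Integrable K
  integral_eq_one : ∫ p, K p = 1

lemma IsBddKernel.integrable_mul (hK : IsBddKernel K A) {g : E → ℝ} (hg : Measurable g) {B : ℝ}
    (hB : ∀ p, |g p| ≤ B) : Integrable fun w => K w * g w :=
  hK.integrable.mul_bdd hg.aestronglyMeasurable (ae_of_all _ hB)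

lemma IsBddKernel.abs_integral_sub_le (hK : IsBddKernel K A) {u v : E → ℝ} (hu : Measurable u)
    (hv : Measurable v) {B : ℝ} (hu' : ∀ w, |u w| ≤ B) (hv' : ∀ w, |v w| ≤ B) {e : E → ℝ}
    (he : Integrable fun w => K w * e w) (h : ∀ w, |u w - v w| ≤ e w) :
    |(∫ w, K w * u w) - ∫ w, K w * v w| ≤ ∫ w, K w * e w := by
  rw [← integral_sub (hK.integrable_mul hu hu') (hK.integrable_mul hv hv')]
  refine (abs_integral_le_integral_abs).trans (integral_mono
    ((hK.integrable_mul hu hu').sub (hK.integrable_mul hv hv')).abs he fun w => ?_)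
  simp only
  rw [← mul_sub, abs_mul, abs_of_nonneg (hK.nonneg w)]
  exact mul_le_mul_of_nonneg_left (h w) (hK.nonneg w)

lemma IsBddKernel.integral_mul_const (hK : IsBddKernel K A) (c : ℝ) : ∫ w, K w * c = c := by
  rw [MeasureTheory.integral_mul_const, hK.integral_eq_one, one_mul]

lemma IsBddKernel.abs_apply_le (hK : IsBddKernel K A) (p : E) : |K p| ≤ A := by
  rw [abs_of_nonneg (hK.nonneg p)]; exact hK.le p

end Kernel

section Smoothing

lemma measurable_sub_smul {E : Type*} [NormedAddCommGroup E] [NormedSpace ℝ E]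
    [MeasurableSpace E] [BorelSpace E] (b : ℝ) (p : E) : Measurable fun w => p - b • w :=
  (continuous_const.sub (continuous_const_smul b)).measurable

lemma continuous_of_abs_sub_le {E : Type*} [NormedAddCommGroup E] {g : E → ℝ} {L : ℝ} (hg : ∀ p q, |g p - g q| ≤ L * ‖p - q‖) :
    Continuous g := by
  refine (LipschitzWith.of_dist_le_mul (K := L.toNNReal) fun p q => ?_).continuous
  rw [Real.dist_eq, dist_eq_norm]
  exact (hg p q).trans (by gcongr; exact Real.le_coe_toNNReal L)

/-- If `g p > 2`, then `g ≥ g p - 1 > 1` on the ball of radius `1 / L`, whose volume is at least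
`1`; the total mass would exceed one. -/
lemma le_two_of_density {E : Type*} [NormedAddCommGroup E] [MeasureSpace E]
    [OpensMeasurableSpace E] {g : E → ℝ} {L : ℝ}
    (hg : ∀ p q, |g p - g q| ≤ L * ‖p - q‖) (hL : 0 < L)
    (hint : ∫⁻ p, ENNReal.ofReal (g p) ≤ 1)
    (hvol : ∀ p : E, 1 ≤ volume (Metric.closedBall p (1 / L))) (p : E) : g p ≤ 2 := by
  by_contra hcon
  push Not at hcon
  have h1 : ∀ q ∈ Metric.closedBall p (1 / L), ENNReal.ofReal (g p - 1) ≤ ENNReal.ofReal (g q) := by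
    intro q hq
    refine ENNReal.ofReal_le_ofReal ?_
    have h2 := (abs_le.1 (hg p q)).2
    rw [Metric.mem_closedBall, dist_comm, dist_eq_norm, le_div_iff₀ hL] at hq
    linarith
  have h3 : ENNReal.ofReal (g p - 1) * volume (Metric.closedBall p (1 / L))
      ≤ ∫⁻ q, ENNReal.ofReal (g q) := by
    rw [← setLIntegral_const]
    exact setLIntegral_mono_ae' (Metric.isClosed_closedBall.measurableSet) (ae_of_all _ h1) |>.trans
      (setLIntegral_le_lintegral _ _)
  have h4 : 1 < ENNReal.ofReal (g p - 1) := by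
    rw [← ENNReal.ofReal_one]
    exact (ENNReal.ofReal_lt_ofReal_iff (by linarith)).2 (by linarith)
  have h5 : ENNReal.ofReal (g p - 1) ≤ 1 :=
    (le_mul_of_one_le_right zero_le (hvol p)).trans (h3.trans hint)
  exact absurd h4 (not_lt.2 h5)

/-- A uniform bound for the error of smoothing an `L`-Lipschitz function with values
in `[0, 2]`. -/
noncomputable def smoothErr {E : Type*} [NormedAddCommGroup E] [MeasureSpace E] (K : E → ℝ) (L b : ℝ) : ℝ := ∫ w, K w * min (L * (b * ‖w‖)) 2

lemma IsBddKernel.integrable_min {E : Type*} [NormedAddCommGroup E] [MeasureSpace E]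
    [BorelSpace E] {K : E → ℝ} {A : ℝ} (hK : IsBddKernel K A) {L b : ℝ} (hL : 0 ≤ L) (hb : 0 ≤ b) :
    Integrable fun w => K w * min (L * (b * ‖w‖)) 2 := by
  refine hK.integrable_mul (by fun_prop) (B := 2) fun w => ?_
  rw [abs_of_nonneg (le_min (by positivity) (by norm_num))]
  exact min_le_right _ _

/-- Truncation at `2` gives the dominating function `2 K`, so no first moment of `K` is needed. -/
lemma IsBddKernel.tendsto_smoothErr {E : Type*} [NormedAddCommGroup E] [MeasureSpace E]
    [BorelSpace E] {K : E → ℝ} {A : ℝ} (hK : IsBddKernel K A) {L : ℝ} (hL : 0 ≤ L) {b : ℕ → ℝ}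
    (hbpos : ∀ n, 0 < b n) (hb0 : Tendsto b atTop (𝓝 0)) :
    Tendsto (fun n => smoothErr K L (b n)) atTop (𝓝 0) := by
  have h0 : (0 : ℝ) = ∫ _ : E, (0 : ℝ) := by simp
  rw [h0]
  refine tendsto_integral_of_dominated_convergence (fun w => K w * 2) ?_
    (hK.integrable.mul_const 2) ?_ ?_
  · exact fun n => (hK.integrable_min hL (hbpos n).le).aestronglyMeasurable
  · refine fun n => ae_of_all _ fun w => ?_
    have : 0 ≤ min (L * (b n * ‖w‖)) 2 :=
      le_min (mul_nonneg hL (mul_nonneg (hbpos n).le (norm_nonneg _))) (by norm_num)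
    rw [Real.norm_eq_abs, abs_of_nonneg (mul_nonneg (hK.nonneg w) this)]
    exact mul_le_mul_of_nonneg_left (min_le_right _ _) (hK.nonneg w)
  · refine ae_of_all _ fun w => ?_
    have h1 : Tendsto (fun n => L * (b n * ‖w‖)) atTop (𝓝 0) := by
      simpa using (hb0.mul_const ‖w‖).const_mul L
    have h2 := (h1.min (tendsto_const_nhds (x := (2 : ℝ)))).const_mul (K w)
    simpa using h2

variable {E : Type*} [NormedAddCommGroup E] [NormedSpace ℝ E] [MeasureSpace E]

/-- The kernel smoothing `p ↦ b⁻ᵈ ∫ K((p - q) / b) ν(dq)` of the measure `ν`. -/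
noncomputable def smooth (K : E → ℝ) (b : ℝ) (ν : Measure E) (p : E) : ℝ :=
  (b ^ Module.finrank ℝ E)⁻¹ * ∫ q, K (b⁻¹ • (p - q)) ∂ν

/-- `ν` has a density with values in `[0, 2]` and Lipschitz constant `L`. -/
def HasLipDensity (L : ℝ) (ν : Measure E) : Prop :=
  ∃ g : E → ℝ, (∀ p, 0 ≤ g p) ∧ (∀ p, g p ≤ 2) ∧ (∀ p q, |g p - g q| ≤ L * ‖p - q‖) ∧
    ν = volume.withDensity fun p => ENNReal.ofReal (g p)

variable [BorelSpace E] [FiniteDimensional ℝ E] [(volume : Measure E).IsAddHaarMeasure]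
  {K : E → ℝ} {A : ℝ}

lemma smooth_eq_integral (K : E → ℝ) {b : ℝ} (hb : 0 < b) {g : E → ℝ} (hg0 : ∀ p, 0 ≤ g p)
    (hg : Measurable g) (p : E) :
    smooth K b (volume.withDensity fun p => ENNReal.ofReal (g p)) p
      = ∫ w, K w * g (p - b • w) := by
  rw [smooth, integral_withDensity_eq_integral_toReal_smul hg.ennreal_ofReal
    (ae_of_all _ fun _ => ENNReal.ofReal_lt_top)]
  have h1 := integral_sub_left_eq_self (μ := (volume : Measure E))
    (fun s => K (b⁻¹ • s) * g (p - s)) p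
  have h2 := Measure.integral_comp_smul (volume : Measure E)
    (fun w => K w * g (p - b • w)) b⁻¹
  simp only [smul_inv_smul₀ hb.ne', sub_sub_cancel] at h1 h2
  simp only [ENNReal.toReal_ofReal (hg0 _), smul_eq_mul]
  simp only [mul_comm (g _)]
  rw [h1, h2, inv_pow, inv_inv, abs_of_pos (by positivity), smul_eq_mul, ← mul_assoc,
    inv_mul_cancel₀ (by positivity), one_mul]

lemma IsBddKernel.abs_smooth_sub_le (hK : IsBddKernel K A) {L b : ℝ} (hL : 0 ≤ L) (hb : 0 < b)
    {g : E → ℝ} (hg0 : ∀ p, 0 ≤ g p) (hg2 : ∀ p, g p ≤ 2)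
    (hg : ∀ p q, |g p - g q| ≤ L * ‖p - q‖) (p : E) :
    |smooth K b (volume.withDensity fun p => ENNReal.ofReal (g p)) p - g p|
      ≤ smoothErr K L b := by
  have hgm : Measurable g := (continuous_of_abs_sub_le hg).measurable
  have habs : ∀ q, |g q| ≤ 2 := fun q => abs_le.2 ⟨by linarith [hg0 q], hg2 q⟩
  rw [smooth_eq_integral K hb hg0 hgm]
  conv_lhs => rw [← hK.integral_mul_const (g p)]
  refine hK.abs_integral_sub_le (hgm.comp (measurable_sub_smul b _)) measurable_const (fun w => habs _)
    (fun _ => habs p) (hK.integrable_min hL hb.le) fun w => le_min ?_ ?_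
  · refine (hg _ _).trans_eq ?_
    rw [sub_sub_cancel_left, norm_neg, norm_smul, Real.norm_eq_abs, abs_of_pos hb]
  · simp only [Function.comp_apply]
    exact abs_le.2 ⟨by linarith [hg0 (p - b • w), hg2 p], by linarith [hg2 (p - b • w), hg0 p]⟩

/-- Smoothing averages translates of the density, so the Lipschitz constant survives for every
bandwidth. -/
lemma IsBddKernel.abs_smooth_sub_smooth_le (hK : IsBddKernel K A) {L b : ℝ}
    (hb : 0 < b) {ν : Measure E} (hν : HasLipDensity L ν) (p q : E) :
    |smooth K b ν p - smooth K b ν q| ≤ L * ‖p - q‖ := by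
  obtain ⟨g, hg0, hg2, hg, rfl⟩ := hν
  have hgm : Measurable g := (continuous_of_abs_sub_le hg).measurable
  have habs : ∀ q, |g q| ≤ 2 := fun q => abs_le.2 ⟨by linarith [hg0 q], hg2 q⟩
  rw [smooth_eq_integral K hb hg0 hgm, smooth_eq_integral K hb hg0 hgm]
  conv_rhs => rw [← hK.integral_mul_const (L * ‖p - q‖)]
  refine hK.abs_integral_sub_le (hgm.comp (measurable_sub_smul b _)) (hgm.comp (measurable_sub_smul b _))
    (fun w => habs _) (fun _ => habs _) (hK.integrable.mul_const _) fun w => ?_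
  refine (hg _ _).trans_eq ?_
  rw [sub_sub_sub_cancel_right]

lemma IsBddKernel.tendsto_smooth (hK : IsBddKernel K A) {f : E → ℝ} (hf0 : ∀ p, 0 ≤ f p)
    (hf : Continuous f) {B : ℝ} (hB : ∀ p, f p ≤ B) {b : ℕ → ℝ}
    (hbpos : ∀ n, 0 < b n) (hb0 : Tendsto b atTop (𝓝 0)) (p : E) :
    Tendsto (fun n => smooth K (b n) (volume.withDensity fun p => ENNReal.ofReal (f p)) p)
      atTop (𝓝 (f p)) := by
  simp_rw [smooth_eq_integral K (hbpos _) hf0 hf.measurable]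
  conv => enter [3]; rw [← hK.integral_mul_const (f p)]
  have habs : ∀ q, |f q| ≤ B := fun q => by rw [abs_of_nonneg (hf0 q)]; exact hB q
  refine tendsto_integral_of_dominated_convergence (fun w => K w * B) ?_
    (hK.integrable.mul_const B) ?_ ?_
  · exact fun n => (hK.integrable_mul (hf.measurable.comp (measurable_sub_smul _ p))
      fun w => habs _).aestronglyMeasurable
  · refine fun n => ae_of_all _ fun w => ?_
    rw [Real.norm_eq_abs, abs_of_nonneg (mul_nonneg (hK.nonneg w) (hf0 _))]
    exact mul_le_mul_of_nonneg_left (hB _) (hK.nonneg w)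
  · refine ae_of_all _ fun w => Tendsto.const_mul _ ?_
    have h1 : Tendsto (fun n => p - b n • w) atTop (𝓝 p) := by
      simpa using (tendsto_const_nhds (x := p)).sub (hb0.smul_const w)
    exact (hf.tendsto p).comp h1

end Smoothing

/-! ### Ergodic averages of smoothed transition densities -/

/-- Equi-Lipschitz functions which converge on a dense set to a continuous function converge
locally uniformly. -/
lemma tendstoUniformlyOn_of_dense {E : Type*} [NormedAddCommGroup E] {F : ℕ → E → ℝ} {f : E → ℝ}
    {L : ℝ} (hL : 0 ≤ L) (hF : ∀ n p q, |F n p - F n q| ≤ L * ‖p - q‖) (hf : Continuous f)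
    {D : Set E} (hD : Dense D) (hFD : ∀ p ∈ D, Tendsto (fun n => F n p) atTop (𝓝 (f p)))
    {S : Set E} (hS : IsCompact S) : TendstoUniformlyOn F f atTop S := by
  rw [← tendstoLocallyUniformlyOn_iff_tendstoUniformlyOn_of_compact hS,
    Metric.tendstoLocallyUniformlyOn_iff]
  intro ε hε x _
  obtain ⟨δ, hδ, hfδ⟩ := Metric.continuous_iff.1 hf x (ε / 4) (by positivity)
  -- A point of the ball and the dense point `d` are within `2 r`; the `+ 1` covers `L = 0`.
  set r := min δ (ε / (8 * (L + 1)))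
  have hr : 0 < r := by positivity
  have hLr : L * (2 * r) ≤ ε / 4 := by
    have h1 : r ≤ ε / (8 * (L + 1)) := min_le_right _ _
    rw [le_div_iff₀ (by positivity)] at h1
    nlinarith
  obtain ⟨d, hdD, hd⟩ := Metric.dense_iff.1 hD x r hr
  rw [Metric.mem_ball] at hdD
  refine ⟨Metric.ball x r, mem_nhdsWithin_of_mem_nhds (Metric.ball_mem_nhds x hr), ?_⟩
  filter_upwards [(Metric.tendsto_nhds.1 (hFD d hd)) (ε / 4) (by positivity)] with n hn y hy
  rw [Metric.mem_ball] at hy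
  have h1 := hfδ y (hy.trans_le (min_le_left _ _))
  have h2 := hfδ d (hdD.trans_le (min_le_left _ _))
  have h3 : |F n y - F n d| ≤ ε / 4 := by
    refine (hF n y d).trans (le_trans ?_ hLr)
    rw [← dist_eq_norm]
    gcongr
    linarith [dist_triangle_right y d x]
  rw [Real.dist_eq] at *
  have a1 := abs_lt.1 h1
  have a2 := abs_lt.1 h2
  have a3 := abs_le.1 h3
  have a4 := abs_lt.1 hn
  exact abs_lt.2 ⟨by linarith, by linarith⟩

section Ergodic

variable {Ω : Type*} [MeasurableSpace Ω] {μ : Measure Ω} [IsProbabilityMeasure μ]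
  {T : ℕ → Ω → ℝ}

lemma IsErgodicSeq.ae_tendsto_average (herg : IsErgodicSeq T μ) (hstat : IsStationarySeq T μ)
    (hT : ∀ i, Measurable (T i)) {φ : ℝ → ℝ} (hφ : Measurable φ) {C : ℝ} (hC : ∀ x, |φ x| ≤ C) :
    ∀ᵐ ω ∂μ, Tendsto (fun n : ℕ => (∑ i ∈ Finset.range n, φ (T i ω)) / n) atTop
      (𝓝 (∫ x, φ x ∂(μ.map (T 0)))) := by
  have hTm : Measurable (fun ω i => T i ω) := measurable_pi_lambda _ hT
  have hp : IsProbabilityMeasure (seqLaw T μ) := Measure.isProbabilityMeasure_map hTm.aemeasurable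
  have herg' : Ergodic seqShift (seqLaw T μ) := { hstat, herg with }
  have h := ae_tendsto_birkhoffSum_div herg' (hφ.comp (measurable_pi_apply 0))
    (C := C) fun x => hC _
  have h2 := ae_of_ae_map hTm.aemeasurable h
  have h3 : ∫ x, (φ ∘ fun y : ℕ → ℝ => y 0) x ∂(seqLaw T μ) = ∫ x, φ x ∂(μ.map (T 0)) := by
    rw [seqLaw, integral_map hTm.aemeasurable
      (hφ.comp (measurable_pi_apply 0)).aestronglyMeasurable,
      integral_map (hT 0).aemeasurable hφ.aestronglyMeasurable]
    rfl
  rw [h3] at h2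
  filter_upwards [h2] with ω hω
  simpa [birkhoffSum, seqShift_iterate] using hω

variable {E : Type*} [NormedAddCommGroup E] [NormedSpace ℝ E] [MeasureSpace E] {K : E → ℝ} {A : ℝ}

lemma IsBddKernel.abs_smooth_le (hK : IsBddKernel K A) {b : ℝ} (hb : 0 < b) (p : E)
    (ν : Measure E) [IsProbabilityMeasure ν] :
    |smooth K b ν p| ≤ (b ^ Module.finrank ℝ E)⁻¹ * A := by
  rw [smooth, abs_mul, abs_of_pos (by positivity : 0 < (b ^ Module.finrank ℝ E)⁻¹)]
  gcongr
  have := norm_integral_le_of_norm_le_const (μ := ν) (f := fun q => K (b⁻¹ • (p - q))) (C := A)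
    (ae_of_all _ fun q => hK.abs_apply_le _)
  simpa using this

variable [BorelSpace E]

lemma IsBddKernel.measurable_sub_smul (hK : IsBddKernel K A) (b : ℝ) (p : E) :
    Measurable fun q => K (b⁻¹ • (p - q)) :=
  hK.measurable.comp ((continuous_const.sub continuous_id).const_smul b⁻¹).measurable

lemma IsBddKernel.measurable_smooth (hK : IsBddKernel K A) (b : ℝ) (p : E) (η : Kernel ℝ E) :
    Measurable fun x => smooth K b (η x) p :=
  ((hK.measurable_sub_smul b p).stronglyMeasurable.integral_kernel).measurable.const_mul _

/-- Smoothing is linear in the measure. With `m` the stationary law this identifies the limit of the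
ergodic averages. -/
lemma IsBddKernel.integral_smooth (hK : IsBddKernel K A) (b : ℝ) (p : E)
    (m : Measure ℝ) [IsProbabilityMeasure m] (η : Kernel ℝ E) [IsMarkovKernel η] :
    ∫ x, smooth K b (η x) p ∂m = smooth K b (η ∘ₘ m) p := by
  have hF := hK.measurable_sub_smul b p
  simp only [smooth]
  rw [integral_const_mul, ← Measure.snd_compProd, Measure.snd,
    integral_map measurable_snd.aemeasurable hF.aestronglyMeasurable,
    Measure.integral_compProd]
  exact Integrable.of_bound (hF.comp measurable_snd).aestronglyMeasurable A
    (ae_of_all _ fun q => hK.abs_apply_le _)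

variable [FiniteDimensional ℝ E] [(volume : Measure E).IsAddHaarMeasure]

/-- Ergodic averages of the smoothed transitions converge to the stationary density, uniformly
on compact sets. -/
theorem IsErgodicSeq.ae_tendstoUniformlyOn_average_smooth (herg : IsErgodicSeq T μ)
    (hstat : IsStationarySeq T μ) (hT : ∀ i, Measurable (T i)) (hK : IsBddKernel K A)
    {η : Kernel ℝ E} [IsMarkovKernel η] {L : ℝ} (hL : 0 ≤ L)
    (hη : ∀ᵐ x ∂(μ.map (T 0)), HasLipDensity L (η x))
    {f : E → ℝ} (hf0 : ∀ p, 0 ≤ f p) (hf : Continuous f) {B : ℝ} (hB : ∀ p, f p ≤ B)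
    (hfη : η ∘ₘ (μ.map (T 0)) = volume.withDensity fun p => ENNReal.ofReal (f p))
    {b : ℕ → ℝ} (hbpos : ∀ n, 0 < b n) (hb0 : Tendsto b atTop (𝓝 0))
    {S : Set E} (hS : IsCompact S) :
    ∀ᵐ ω ∂μ, TendstoUniformlyOn
      (fun (n : ℕ) p => (∑ i ∈ Finset.range n, smooth K (b n) (η (T i ω)) p) / n) f atTop S := by
  have hgood : ∀ᵐ ω ∂μ, ∀ i, HasLipDensity L (η (T i ω)) := by
    refine ae_all_iff.2 fun i => ?_
    rw [← hstat.map_eq hT i] at hη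
    exact ae_of_ae_map (hT i).aemeasurable hη
  have hm : IsProbabilityMeasure (μ.map (T 0)) :=
    Measure.isProbabilityMeasure_map (hT 0).aemeasurable
  -- The ergodic theorem needs a fixed function, so it is applied at countably many frozen
  -- bandwidths `δ m`. The bound `herr`, uniform over the transitions, replaces `δ m` by `b n`.
  set δ : ℕ → ℝ := fun m => 1 / (m + 1 : ℝ)
  have hδ : ∀ m, 0 < δ m := fun m => by positivity
  have hδ0 : Tendsto δ atTop (𝓝 0) := tendsto_one_div_add_atTop_nhds_zero_nat
  have herr : ∀ {x b b' p}, HasLipDensity L (η x) → 0 < b → 0 < b' →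
      |smooth K b (η x) p - smooth K b' (η x) p| ≤ smoothErr K L b + smoothErr K L b' := by
    rintro x b b' p ⟨g, hg0, hg2, hg, hgη⟩ hb hb'
    have h1 := hK.abs_smooth_sub_le hL hb hg0 hg2 hg p
    have h2 := hK.abs_smooth_sub_le hL hb' hg0 hg2 hg p
    rw [hgη]
    rw [abs_sub_comm] at h2
    exact (abs_sub_le _ (g p) _).trans (add_le_add h1 h2)
  have hpt : ∀ p, ∀ᵐ ω ∂μ, Tendsto
      (fun n : ℕ => (∑ i ∈ Finset.range n, smooth K (b n) (η (T i ω)) p) / n) atTop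
      (𝓝 (f p)) := by
    intro p
    have hbirk : ∀ᵐ ω ∂μ, ∀ m, Tendsto
        (fun n : ℕ => (∑ i ∈ Finset.range n, smooth K (δ m) (η (T i ω)) p) / n) atTop
        (𝓝 (smooth K (δ m) (volume.withDensity fun p => ENNReal.ofReal (f p)) p)) := by
      refine ae_all_iff.2 fun m => ?_
      rw [← hfη, ← hK.integral_smooth]
      exact herg.ae_tendsto_average hstat hT (hK.measurable_smooth (δ m) p η)
        fun x => hK.abs_smooth_le (hδ m) p (η x)
    filter_upwards [hbirk, hgood] with ω h1 h2
    rw [Metric.tendsto_nhds]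
    intro ε hε
    have e1 := (hK.tendsto_smoothErr hL hδ hδ0).eventually_lt_const
      (show 0 < ε / 4 by positivity)
    have e2 := Metric.tendsto_nhds.1 (hK.tendsto_smooth hf0 hf hB hδ hδ0 p) (ε / 4) (by positivity)
    obtain ⟨m, hm1, hm2⟩ := (e1.and e2).exists
    filter_upwards [Metric.tendsto_nhds.1 (h1 m) (ε / 4) (by positivity),
      (hK.tendsto_smoothErr hL hbpos hb0).eventually_lt_const (show 0 < ε / 4 by positivity),
      eventually_ge_atTop 1] with n g1 g2 hn
    have hn0 : (0 : ℝ) < n := by exact_mod_cast hn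
    have g3 : |(∑ i ∈ Finset.range n, smooth K (b n) (η (T i ω)) p) / n
        - (∑ i ∈ Finset.range n, smooth K (δ m) (η (T i ω)) p) / n|
        ≤ smoothErr K L (b n) + smoothErr K L (δ m) := by
      rw [← sub_div, ← Finset.sum_sub_distrib, abs_div, abs_of_pos hn0, div_le_iff₀ hn0]
      refine (Finset.abs_sum_le_sum_abs _ _).trans
        ((Finset.sum_le_sum fun i _ => herr (p := p) (h2 i) (hbpos n) (hδ m)).trans_eq ?_)
      rw [Finset.sum_const, Finset.card_range, nsmul_eq_mul, mul_comm]
    rw [Real.dist_eq] at *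
    have a1 := abs_lt.1 g1
    have a2 := abs_lt.1 hm2
    have a3 := abs_le.1 g3
    exact abs_lt.2 ⟨by linarith, by linarith⟩
  obtain ⟨D, hDc, hD⟩ := TopologicalSpace.exists_countable_dense E
  have hptD : ∀ᵐ ω ∂μ, ∀ p ∈ D, Tendsto
      (fun n : ℕ => (∑ i ∈ Finset.range n, smooth K (b n) (η (T i ω)) p) / n) atTop
      (𝓝 (f p)) := (ae_ball_iff hDc).2 fun p _ => hpt p
  filter_upwards [hptD, hgood] with ω h1 h2
  refine tendstoUniformlyOn_of_dense hL (fun n p q => ?_) hf hD h1 hS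
  -- For `n = 0` the average is `0`.
  rcases Nat.eq_zero_or_pos n with rfl | hn
  · simp; positivity
  have hn0 : (0 : ℝ) < n := by exact_mod_cast hn
  rw [← sub_div, ← Finset.sum_sub_distrib, abs_div, abs_of_pos hn0, div_le_iff₀ hn0]
  refine (Finset.abs_sum_le_sum_abs _ _).trans
    ((Finset.sum_le_sum fun i _ => hK.abs_smooth_sub_smooth_le (hbpos n) (h2 i) p q).trans_eq ?_)
  simp; ring

end Ergodic

/-! ### Kernels of bounded variation -/

/-- `K` is a difference of two bounded nonnegative monotone functions. -/
def IsMonotoneDiff (K : ℝ → ℝ) : Prop :=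
  ∃ (G H : ℝ → ℝ) (C : ℝ), 0 < C ∧ Monotone G ∧ Monotone H ∧ (∀ x, G x ∈ Icc 0 C) ∧
    (∀ x, H x ∈ Icc 0 C) ∧ ∀ x, K x = G x - H x

/-- The marginal estimator is treated as a product functional whose second factor is constant. -/
lemma isMonotoneDiff_one : IsMonotoneDiff fun _ => 1 :=
  ⟨fun _ => 1, fun _ => 0, 1, one_pos, monotone_const, monotone_const, by simp, by simp, by simp⟩

/-- Jordan decomposition: the variation from `0` and that variation minus `K` are monotone. The
shift `V + B` makes both nonnegative, and the `+ 1` keeps the bound positive. -/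
lemma BoundedVariationOn.isMonotoneDiff {K : ℝ → ℝ} (hK : BoundedVariationOn K univ) :
    IsMonotoneDiff K := by
  set V := (eVariationOn K univ).toReal
  set B := V + |K 0|
  have hV : 0 ≤ V := ENNReal.toReal_nonneg
  have hB : 0 ≤ B := by positivity
  have hKB : ∀ x, |K x| ≤ B := by
    intro x
    have h := hK.dist_le (mem_univ x) (mem_univ 0)
    rw [Real.dist_eq] at h
    have := abs_sub_abs_le_abs_sub (K x) (K 0)
    linarith
  have hvar : ∀ x, |variationOnFromTo K univ 0 x| ≤ V := by
    intro x
    rw [variationOnFromTo]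
    split_ifs
    · rw [abs_of_nonneg ENNReal.toReal_nonneg]
      exact ENNReal.toReal_mono hK (eVariationOn.mono _ (subset_univ _))
    · rw [abs_neg, abs_of_nonneg ENNReal.toReal_nonneg]
      exact ENNReal.toReal_mono hK (eVariationOn.mono _ (subset_univ _))
  have hl := hK.locallyBoundedVariationOn
  have m1 := monotoneOn_univ.1 (variationOnFromTo.monotoneOn hl (mem_univ 0))
  have m2 := monotoneOn_univ.1 (variationOnFromTo.sub_self_monotoneOn hl (mem_univ 0))
  refine ⟨fun x => variationOnFromTo K univ 0 x + (V + B),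
    fun x => (variationOnFromTo K univ 0 - K) x + (V + B), 2 * (V + B) + 1, by positivity,
    fun x y h => add_le_add_left (m1 h) _, fun x y h => add_le_add_left (m2 h) _,
    fun x => ?_, fun x => ?_, fun x => ?_⟩
  · have := abs_le.1 (hvar x)
    constructor <;> linarith
  · have := abs_le.1 (hvar x)
    have := abs_le.1 (hKB x)
    constructor <;> simp only [Pi.sub_apply] <;> linarith
  · simp only [Pi.sub_apply]; ring

lemma IsMonotoneDiff.measurable {K : ℝ → ℝ} (hK : IsMonotoneDiff K) : Measurable K := by
  obtain ⟨G, H, C, -, hG, hH, -, -, hKGH⟩ := hK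
  rw [funext hKGH]
  exact hG.measurable.sub hH.measurable

lemma IsMonotoneDiff.exists_abs_le {K : ℝ → ℝ} (hK : IsMonotoneDiff K) : ∃ A, ∀ x, |K x| ≤ A := by
  obtain ⟨G, H, C, -, -, -, hG, hH, hKGH⟩ := hK
  refine ⟨C, fun x => ?_⟩
  rw [hKGH]
  exact abs_le.2 ⟨by linarith [(hG x).1, (hH x).2], by linarith [(hG x).2, (hH x).1]⟩

lemma IsKernel.isMonotoneDiff {K : ℝ → ℝ} (hK : IsKernel K) : IsMonotoneDiff K :=
  hK.boundedVariation.isMonotoneDiff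

lemma IsKernel.exists_isBddKernel {K : ℝ → ℝ} (hK : IsKernel K) : ∃ A, IsBddKernel K A := by
  obtain ⟨A, hA⟩ := hK.isMonotoneDiff.exists_abs_le
  exact ⟨A, hK.isMonotoneDiff.measurable, hK.nonneg, fun p => (le_abs_self _).trans (hA p),
    hK.integrable, hK.integral_eq_one⟩

lemma IsBddKernel.prod {K₁ K₂ : ℝ → ℝ} {A₁ A₂ : ℝ} (h₁ : IsBddKernel K₁ A₁)
    (h₂ : IsBddKernel K₂ A₂) : IsBddKernel (fun p : ℝ × ℝ => K₁ p.1 * K₂ p.2) (A₁ * A₂) where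
  measurable := (h₁.measurable.comp measurable_fst).mul (h₂.measurable.comp measurable_snd)
  nonneg p := mul_nonneg (h₁.nonneg _) (h₂.nonneg _)
  le p := mul_le_mul (h₁.le _) (h₂.le _) (h₂.nonneg _) ((h₁.nonneg 0).trans (h₁.le 0))
  integrable := h₁.integrable.mul_prod h₂.integrable
  integral_eq_one := by
    rw [Measure.volume_eq_prod, integral_prod_mul, h₁.integral_eq_one, h₂.integral_eq_one, one_mul]

/-! ### Uniform deviations for kernels of bounded variation -/

lemma twoStepDev_sub {Ω : Type*} {T : ℕ → Ω → ℝ} {κ : Kernel ℝ ℝ} [IsMarkovKernel κ]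
    {Φ Φ₁ Φ₂ : ℝ × ℝ → ℝ} {C : ℝ} (h₁ : Measurable Φ₁) (h₁' : ∀ q, |Φ₁ q| ≤ C)
    (h₂ : Measurable Φ₂) (h₂' : ∀ q, |Φ₂ q| ≤ C) (h : ∀ q, Φ q = Φ₁ q - Φ₂ q) (n : ℕ) (ω : Ω) :
    twoStepDev κ T Φ n ω = twoStepDev κ T Φ₁ n ω - twoStepDev κ T Φ₂ n ω := by
  have i₁ : ∀ x, Integrable Φ₁ (twoStep κ x) := fun x =>
    Integrable.of_bound h₁.aestronglyMeasurable C (ae_of_all _ h₁')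
  have i₂ : ∀ x, Integrable Φ₂ (twoStep κ x) := fun x =>
    Integrable.of_bound h₂.aestronglyMeasurable C (ae_of_all _ h₂')
  simp only [twoStepDev]
  rw [← Finset.sum_sub_distrib]
  refine Finset.sum_congr rfl fun i _ => ?_
  have : ∫ q, Φ q ∂(twoStep κ (T i ω))
      = ∫ q, Φ₁ q ∂(twoStep κ (T i ω)) - ∫ q, Φ₂ q ∂(twoStep κ (T i ω)) := by
    rw [← integral_sub (i₁ _) (i₂ _)]
    exact integral_congr_ae (ae_of_all _ h)
  rw [this, h]
  ring

lemma abs_prodKer_le {G H : ℝ → ℝ} {C : ℝ} (hG : ∀ x, |G x| ≤ C) (hH : ∀ x, |H x| ≤ C)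
    (b τ t : ℝ) (q : ℝ × ℝ) : |prodKer G H b τ t q| ≤ C * C := by
  rw [prodKer, abs_mul]
  exact mul_le_mul (hG _) (hH _) (abs_nonneg _) ((abs_nonneg _).trans (hG 0))

/-! ### Uniform consistency of the density estimators. -/

section Estimators

lemma HasLipDensity.le_two_smul {E : Type*} [NormedAddCommGroup E] [NormedSpace ℝ E]
    [MeasureSpace E] {L : ℝ} {ν : Measure E} (h : HasLipDensity L ν) :
    ν ≤ (2 : ℝ≥0∞) • volume := by
  obtain ⟨g, -, hg2, -, rfl⟩ := h
  rw [← withDensity_const]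
  refine withDensity_mono (ae_of_all _ fun p => ?_)
  rw [← ENNReal.ofReal_ofNat]
  exact ENNReal.ofReal_le_ofReal (hg2 p)

variable {Ω : Type*} [MeasurableSpace Ω] {μ : Measure Ω} [IsProbabilityMeasure μ]
  {T : ℕ → Ω → ℝ} {κ : Kernel ℝ ℝ} [IsMarkovKernel κ] {b : ℕ → ℝ}

/-- A product of two differences expands into four products of monotone functions, each controlled
up to `ε / 4`. -/
theorem HasTransition.ae_eventually_twoStepDev_isMonotoneDiff_le (hκ : HasTransition T μ κ)
    (hT : ∀ i, Measurable (T i)) (hstat : IsStationarySeq T μ)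
    (hdom : ∀ᵐ x ∂(μ.map (T 0)), κ x ≤ (2 : ℝ≥0∞) • volume)
    (hbpos : ∀ n, 0 < b n) (hb0 : Tendsto b atTop (𝓝 0))
    (hb : Tendsto (fun n : ℕ => n * b n ^ 4 / Real.log n) atTop atTop)
    {K₁ K₂ : ℝ → ℝ} (hK₁ : IsMonotoneDiff K₁) (hK₂ : IsMonotoneDiff K₂) {M : ℝ} (hM : 0 < M) :
    ∀ᵐ ω ∂μ, ∀ ε > 0, ∀ᶠ n : ℕ in atTop, ∀ τ ∈ Icc 0 M, ∀ t ∈ Icc 0 M,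
      |twoStepDev κ T (prodKer K₁ K₂ (b n) τ t) n ω| ≤ ε * (n * b n ^ 2) := by
  obtain ⟨A₁, hA₁⟩ := hK₁.exists_abs_le
  have hK₁m := hK₁.measurable
  obtain ⟨G₁, H₁, C₁, hC₁, hG₁, hH₁, hG₁C, hH₁C, hKGH₁⟩ := hK₁
  obtain ⟨G₂, H₂, C₂, hC₂, hG₂, hH₂, hG₂C, hH₂C, hKGH₂⟩ := hK₂
  -- `A₁` enters because the second factor is split first, which leaves products with `K₁` itself.
  set C := max A₁ (max C₁ C₂)
  have hC : 0 < C := lt_max_of_lt_right (lt_max_of_lt_left hC₁)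
  have c₁ : C₁ ≤ C := (le_max_left _ _).trans (le_max_right _ _)
  have c₂ : C₂ ≤ C := (le_max_right _ _).trans (le_max_right _ _)
  have mem : ∀ {F : ℝ → ℝ} {D : ℝ}, D ≤ C → (∀ x, F x ∈ Icc 0 D) → ∀ x, F x ∈ Icc 0 C :=
    fun hD hF x => ⟨(hF x).1, (hF x).2.trans hD⟩
  have abs_mem : ∀ {F : ℝ → ℝ}, (∀ x, F x ∈ Icc 0 C) → ∀ x, |F x| ≤ C :=
    fun hF x => by rw [abs_of_nonneg (hF x).1]; exact (hF x).2
  replace hG₁C := mem c₁ hG₁C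
  replace hH₁C := mem c₁ hH₁C
  replace hG₂C := mem c₂ hG₂C
  replace hH₂C := mem c₂ hH₂C
  have hA₁C : ∀ x, |K₁ x| ≤ C := fun x => (hA₁ x).trans (le_max_left _ _)
  have key : ∀ {G H : ℝ → ℝ}, Monotone G → Monotone H → (∀ x, G x ∈ Icc 0 C) →
      (∀ x, H x ∈ Icc 0 C) → _ := fun hG hH hGC hHC =>
    hκ.ae_eventually_twoStepDev_le hT hstat hdom hbpos hb0 hb hG hH hC hGC hHC hM
  filter_upwards [key hG₁ hG₂ hG₁C hG₂C, key hG₁ hH₂ hG₁C hH₂C, key hH₁ hG₂ hH₁C hG₂C,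
    key hH₁ hH₂ hH₁C hH₂C] with ω h1 h2 h3 h4 ε hε
  filter_upwards [h1 (ε / 4) (by positivity), h2 (ε / 4) (by positivity),
    h3 (ε / 4) (by positivity), h4 (ε / 4) (by positivity)] with n g1 g2 g3 g4 τ hτ t ht
  have s0 : twoStepDev κ T (prodKer K₁ K₂ (b n) τ t) n ω
      = twoStepDev κ T (prodKer K₁ G₂ (b n) τ t) n ω
        - twoStepDev κ T (prodKer K₁ H₂ (b n) τ t) n ω :=
    twoStepDev_sub (measurable_prodKer hK₁m hG₂.measurable _ _ _)
      (abs_prodKer_le hA₁C (abs_mem hG₂C) _ _ _)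
      (measurable_prodKer hK₁m hH₂.measurable _ _ _)
      (abs_prodKer_le hA₁C (abs_mem hH₂C) _ _ _)
      (fun q => by simp only [prodKer, hKGH₂]; ring) n ω
  have s1 : ∀ {F : ℝ → ℝ}, Measurable F → (∀ x, F x ∈ Icc 0 C) →
      twoStepDev κ T (prodKer K₁ F (b n) τ t) n ω
      = twoStepDev κ T (prodKer G₁ F (b n) τ t) n ω
        - twoStepDev κ T (prodKer H₁ F (b n) τ t) n ω := fun hF hFC =>
    twoStepDev_sub (measurable_prodKer hG₁.measurable hF _ _ _)
      (abs_prodKer_le (abs_mem hG₁C) (abs_mem hFC) _ _ _)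
      (measurable_prodKer hH₁.measurable hF _ _ _)
      (abs_prodKer_le (abs_mem hH₁C) (abs_mem hFC) _ _ _)
      (fun q => by simp only [prodKer, hKGH₁]; ring) n ω
  rw [s0, s1 hG₂.measurable hG₂C, s1 hH₂.measurable hH₂C]
  have a1 := abs_le.1 (g1 τ hτ t ht)
  have a2 := abs_le.1 (g2 τ hτ t ht)
  have a3 := abs_le.1 (g3 τ hτ t ht)
  have a4 := abs_le.1 (g4 τ hτ t ht)
  exact abs_le.2 ⟨by linarith, by linarith⟩

/-- Uniform almost sure consistency of the kernel estimator of the marginal density. -/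
theorem ae_tendstoUniformlyOn_densEst (hκ : HasTransition T μ κ)
    (hT : ∀ i, Measurable (T i)) (hstat : IsStationarySeq T μ) (herg : IsErgodicSeq T μ)
    {L : ℝ} (hL : 0 ≤ L) (hlip : ∀ᵐ x ∂(μ.map (T 0)), HasLipDensity L (κ x))
    {f : ℝ → ℝ} (hf0 : ∀ p, 0 ≤ f p) (hf : Continuous f) {B : ℝ} (hB : ∀ p, f p ≤ B)
    (hfκ : κ ∘ₘ (μ.map (T 0)) = volume.withDensity fun p => ENNReal.ofReal (f p))
    (hbpos : ∀ n, 0 < b n) (hb0 : Tendsto b atTop (𝓝 0))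
    (hb : Tendsto (fun n : ℕ => n * b n ^ 4 / Real.log n) atTop atTop)
    {K : ℝ → ℝ} (hK : IsKernel K) {M : ℝ} (hM : 0 < M) :
    ∀ᵐ ω ∂μ, TendstoUniformlyOn (fun n t => densEst K b T n ω t) f atTop (Icc 0 M) := by
  obtain ⟨A, hKA⟩ := hK.exists_isBddKernel
  filter_upwards [hκ.ae_eventually_twoStepDev_isMonotoneDiff_le hT hstat
      (hlip.mono fun x hx => hx.le_two_smul) hbpos hb0 hb hK.isMonotoneDiff isMonotoneDiff_one hM,
    herg.ae_tendstoUniformlyOn_average_smooth hstat hT hKA hL hlip hf0 hf hB hfκ hbpos hb0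
      isCompact_Icc] with ω h1 h2
  rw [Metric.tendstoUniformlyOn_iff] at h2 ⊢
  intro ε hε
  filter_upwards [h1 (ε / 2) (by positivity), h2 (ε / 2) (by positivity), eventually_ge_atTop 1,
    hb0.eventually_le_const one_pos] with n g1 g2 hn hbn1 t ht
  have hn0 : (0 : ℝ) < n := by exact_mod_cast hn
  have hbn := hbpos n
  have heq : densEst K b T n ω t - (∑ i ∈ Finset.range n, smooth K (b n) (κ (T i ω)) t) / n
      = twoStepDev κ T (prodKer K (fun _ => 1) (b n) t t) n ω / (n * b n) := by
    have hint : ∀ x, ∫ q, prodKer K (fun _ => 1) (b n) t t q ∂(twoStep κ x)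
        = ∫ y, K ((b n)⁻¹ • (t - y)) ∂κ x := by
      intro x
      rw [integral_twoStep]
      · simp [prodKer, div_eq_inv_mul]
      · exact Integrable.of_bound
          (measurable_prodKer hKA.measurable measurable_const _ _ _).aestronglyMeasurable A
          (ae_of_all _ fun q => by simpa [prodKer] using hKA.abs_apply_le _)
    simp only [twoStepDev, hint, Finset.sum_sub_distrib, densEst, smooth, Module.finrank_self,
      pow_one, ← Finset.mul_sum]
    simp only [prodKer, mul_one]
    field_simp
  have e1 := g1 t ht t ht
  have e2 := g2 t ht
  have e3 : |twoStepDev κ T (prodKer K (fun _ => 1) (b n) t t) n ω / (n * b n)| ≤ ε / 2 := by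
    rw [abs_div, abs_of_pos (by positivity : 0 < n * b n), div_le_iff₀ (by positivity)]
    refine e1.trans ?_
    -- The deviation is controlled on the scale `n bₙ²`, whereas the marginal estimator is
    -- normalised by `n bₙ`, which is larger since `b n ≤ 1`.
    have : b n ^ 2 ≤ b n := by nlinarith
    gcongr
  rw [← heq] at e3
  rw [Real.dist_eq] at *
  have a2 := abs_lt.1 e2
  have a3 := abs_le.1 e3
  exact abs_lt.2 ⟨by linarith, by linarith⟩

/-- Uniform almost sure consistency of the kernel estimator of the joint density. -/
theorem ae_tendstoUniformlyOn_jointDensEst (hκ : HasTransition T μ κ)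
    (hT : ∀ i, Measurable (T i)) (hstat : IsStationarySeq T μ) (herg : IsErgodicSeq T μ)
    (hdom : ∀ᵐ x ∂(μ.map (T 0)), κ x ≤ (2 : ℝ≥0∞) • volume)
    {L : ℝ} (hL : 0 ≤ L) (hlip : ∀ᵐ x ∂(μ.map (T 0)), HasLipDensity L (twoStep κ x))
    {f : ℝ × ℝ → ℝ} (hf0 : ∀ p, 0 ≤ f p) (hf : Continuous f) {B : ℝ} (hB : ∀ p, f p ≤ B)
    (hfκ : twoStep κ ∘ₘ (μ.map (T 0)) = volume.withDensity fun p => ENNReal.ofReal (f p))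
    (hbpos : ∀ n, 0 < b n) (hb0 : Tendsto b atTop (𝓝 0))
    (hb : Tendsto (fun n : ℕ => n * b n ^ 4 / Real.log n) atTop atTop)
    {K₁ K₂ : ℝ → ℝ} (hK₁ : IsKernel K₁) (hK₂ : IsKernel K₂) {M : ℝ} (hM : 0 < M) :
    ∀ᵐ ω ∂μ, TendstoUniformlyOn (fun n p => jointDensEst K₁ K₂ b T n ω p) f atTop
      (Icc 0 M ×ˢ Icc 0 M) := by
  obtain ⟨A₁, hKA₁⟩ := hK₁.exists_isBddKernel
  obtain ⟨A₂, hKA₂⟩ := hK₂.exists_isBddKernel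
  filter_upwards [hκ.ae_eventually_twoStepDev_isMonotoneDiff_le hT hstat
      hdom hbpos hb0 hb hK₁.isMonotoneDiff hK₂.isMonotoneDiff hM,
    herg.ae_tendstoUniformlyOn_average_smooth hstat hT (hKA₁.prod hKA₂) hL hlip hf0 hf hB hfκ
      hbpos hb0 (isCompact_Icc.prod isCompact_Icc)] with ω h1 h2
  rw [Metric.tendstoUniformlyOn_iff] at h2 ⊢
  intro ε hε
  filter_upwards [h1 (ε / 2) (by positivity), h2 (ε / 2) (by positivity), eventually_ge_atTop 1]
    with n g1 g2 hn p hp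
  have hn0 : (0 : ℝ) < n := by exact_mod_cast hn
  have hbn := hbpos n
  have heq : jointDensEst K₁ K₂ b T n ω p
      - (∑ i ∈ Finset.range n,
          smooth (fun p : ℝ × ℝ => K₁ p.1 * K₂ p.2) (b n) (twoStep κ (T i ω)) p) / n
      = twoStepDev κ T (prodKer K₁ K₂ (b n) p.1 p.2) n ω / (n * b n ^ 2) := by
    have hrank : Module.finrank ℝ (ℝ × ℝ) = 2 := by simp
    simp only [twoStepDev, Finset.sum_sub_distrib, jointDensEst, smooth, hrank,
      ← Finset.mul_sum]
    simp only [prodKer, div_eq_inv_mul (_ - _), Prod.smul_fst, Prod.smul_snd, Prod.fst_sub,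
      Prod.snd_sub, smul_eq_mul]
    field_simp
  have e1 := g1 p.1 hp.1 p.2 hp.2
  have e2 := g2 p hp
  have e3 : |twoStepDev κ T (prodKer K₁ K₂ (b n) p.1 p.2) n ω / (n * b n ^ 2)| ≤ ε / 2 := by
    rw [abs_div, abs_of_pos (by positivity : 0 < n * b n ^ 2), div_le_iff₀ (by positivity)]
    exact e1
  rw [← heq] at e3
  rw [Real.dist_eq] at *
  have a2 := abs_lt.1 e2
  have a3 := abs_le.1 e3
  exact abs_lt.2 ⟨by linarith, by linarith⟩

end Estimators

/-! ### Hazard rates of uniformly convergent densities -/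

section Hazard

/-- The parameter in `X` is the conditioning value `τ`; a one-point `X` serves the marginal case. -/
lemma tendstoUniformlyOn_survival {X : Type*} {F : ℕ → X → ℝ → ℝ}
    {G : X → ℝ → ℝ} {S : Set X} {M : ℝ} (hM : 0 < M)
    (hF : ∀ n, ∀ x ∈ S, ∀ t ∈ Icc 0 M, IntervalIntegrable (F n x) volume 0 t)
    (hG : ∀ x ∈ S, ∀ t ∈ Icc 0 M, IntervalIntegrable (G x) volume 0 t)
    (h : TendstoUniformlyOn (fun n (p : X × ℝ) => F n p.1 p.2) (fun p => G p.1 p.2) atTop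
      (S ×ˢ Icc 0 M)) :
    TendstoUniformlyOn (fun n (p : X × ℝ) => survival (F n p.1) p.2)
      (fun p => survival (G p.1) p.2) atTop (S ×ˢ Icc 0 M) := by
  rw [Metric.tendstoUniformlyOn_iff] at h ⊢
  intro ε hε
  filter_upwards [h (ε / (2 * M)) (by positivity)] with n hn p hp
  obtain ⟨h1, h2⟩ := hp
  rw [Real.dist_eq, survival, survival, sub_sub_sub_cancel_left,
    ← intervalIntegral.integral_sub (hF n _ h1 _ h2) (hG _ h1 _ h2)]
  have hle : ∀ s ∈ uIoc 0 p.2, ‖F n p.1 s - G p.1 s‖ ≤ ε / (2 * M) := by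
    intro s hs
    rw [uIoc_of_le h2.1] at hs
    have := hn (p.1, s) ⟨h1, hs.1.le, hs.2.trans h2.2⟩
    rw [dist_comm, Real.dist_eq] at this
    exact this.le
  have := intervalIntegral.norm_integral_le_of_norm_le_const hle
  rw [sub_zero, abs_of_nonneg h2.1, Real.norm_eq_abs] at this
  calc _ ≤ ε / (2 * M) * p.2 := this
    _ ≤ ε / (2 * M) * M := by gcongr; exact h2.2
    _ = ε / 2 := by field_simp
    _ < ε := by linarith

lemma TendstoUniformlyOn.div_of_isCompact {X : Type*} [TopologicalSpace X] {S : Set X}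
    (hS : IsCompact S) {F G : ℕ → X → ℝ} {f g : X → ℝ} (hF : TendstoUniformlyOn F f atTop S)
    (hG : TendstoUniformlyOn G g atTop S) (hf : ContinuousOn f S) (hg : ContinuousOn g S)
    (hg0 : ∀ x ∈ S, g x ≠ 0) :
    TendstoUniformlyOn (fun n x => F n x / G n x) (fun x => f x / g x) atTop S :=
  (tendstoLocallyUniformlyOn_iff_tendstoUniformlyOn_of_compact hS).1
    (hF.tendstoLocallyUniformlyOn.div₀ hG.tendstoLocallyUniformlyOn hf hg hg0)

/-- Hazard rates depend continuously on the density, for uniform convergence. -/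
lemma tendstoUniformlyOn_hazard {X : Type*} [TopologicalSpace X] {F : ℕ → X → ℝ → ℝ}
    {G : X → ℝ → ℝ} {S : Set X} (hS : IsCompact S) {M : ℝ} (hM : 0 < M)
    (hF : ∀ n, ∀ x ∈ S, ∀ t ∈ Icc 0 M, IntervalIntegrable (F n x) volume 0 t)
    (hG : ∀ x ∈ S, ∀ t ∈ Icc 0 M, IntervalIntegrable (G x) volume 0 t)
    (h : TendstoUniformlyOn (fun n (p : X × ℝ) => F n p.1 p.2) (fun p => G p.1 p.2) atTop
      (S ×ˢ Icc 0 M))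
    (hGc : ContinuousOn (fun p : X × ℝ => G p.1 p.2) (S ×ˢ Icc 0 M))
    (hGs : ContinuousOn (fun p : X × ℝ => survival (G p.1) p.2) (S ×ˢ Icc 0 M))
    (hpos : ∀ x ∈ S, ∀ t ∈ Icc 0 M, 0 < survival (G x) t) :
    TendstoUniformlyOn (fun n (p : X × ℝ) => hazard (F n p.1) p.2)
      (fun p => hazard (G p.1) p.2) atTop (S ×ˢ Icc 0 M) :=
  h.div_of_isCompact (hS.prod isCompact_Icc) (tendstoUniformlyOn_survival hM hF hG h) hGc hGs
    fun p hp => (hpos p.1 hp.1 p.2 hp.2).ne'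

lemma continuous_survival {f : ℝ → ℝ} (hf : Continuous f) : Continuous (survival f) := by
  unfold survival
  exact continuous_const.sub
    (intervalIntegral.continuous_primitive (fun a b => hf.intervalIntegrable a b) 0)

/-- The density is positive on `(M, M + ε)`, so some mass lies beyond `M` and the integral over `[0,
t]` stays below one. -/
lemma survival_pos {f : ℝ → ℝ} (hf0 : ∀ t, 0 ≤ f t) (hf : Continuous f) (hfi : Integrable f)
    (hf1 : ∫ t, f t = 1) {M : ℝ} (hM : 0 ≤ M) {ε γ : ℝ} (hε : 0 < ε) (hγ : 0 < γ)
    (hfpos : ∀ t ∈ Ioo M (M + ε), γ < f t) {t : ℝ} (ht : t ∈ Icc 0 M) : 0 < survival f t := by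
  have hi : ∀ a b, IntervalIntegrable f volume a b := fun a b => hf.intervalIntegrable a b
  have h1 : ∫ s in (0 : ℝ)..(M + ε), f s ≤ 1 := by
    rw [intervalIntegral.integral_of_le (by linarith), ← hf1]
    exact setIntegral_le_integral hfi (ae_of_all _ hf0)
  have h2 := intervalIntegral.integral_add_adjacent_intervals (hi 0 t) (hi t M)
  have h3 := intervalIntegral.integral_add_adjacent_intervals (hi 0 M) (hi M (M + ε))
  have h4 : 0 ≤ ∫ s in t..M, f s := intervalIntegral.integral_nonneg ht.2 fun s _ => hf0 s
  have h5 : 0 < ∫ s in M..(M + ε), f s :=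
    intervalIntegral.intervalIntegral_pos_of_pos_on (hi _ _)
      (fun s hs => hγ.trans (hfpos s hs)) (by linarith)
  unfold survival
  linarith

lemma intervalIntegrable_of_abs_le {f : ℝ → ℝ} (hf : Measurable f) {C : ℝ}
    (hC : ∀ t, |f t| ≤ C) (a b : ℝ) : IntervalIntegrable f volume a b :=
  (intervalIntegrable_const (c := C)).mono_fun' hf.aestronglyMeasurable (ae_of_all _ hC)

end Hazard

section Integrability

variable {Ω : Type*} {T : ℕ → Ω → ℝ} {b : ℕ → ℝ} {K K₂ : ℝ → ℝ} {A : ℝ}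

lemma IsBddKernel.intervalIntegrable_comp (hK : IsBddKernel K A) (c s u v : ℝ) :
    IntervalIntegrable (fun t => K ((t - s) / c)) volume u v :=
  intervalIntegrable_of_abs_le (hK.measurable.comp (by fun_prop)) (fun _ => hK.abs_apply_le _) u v

lemma IsBddKernel.intervalIntegrable_densEst (hK : IsBddKernel K A) (n : ℕ) (ω : Ω) (u v : ℝ) :
    IntervalIntegrable (densEst K b T n ω) volume u v := by
  have h := IntervalIntegrable.sum (Finset.range n)
    fun i _ => hK.intervalIntegrable_comp (b n) (T i ω) u v
  rw [Finset.sum_fn] at h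
  exact h.const_mul _

lemma IsBddKernel.intervalIntegrable_jointDensEst (hK : IsBddKernel K₂ A) (n : ℕ) (ω : Ω)
    (τ u v : ℝ) : IntervalIntegrable (fun t => jointDensEst K K₂ b T n ω (τ, t)) volume u v := by
  have h := IntervalIntegrable.sum (Finset.range n) fun i _ =>
    (hK.intervalIntegrable_comp (b n) (T (i + 1) ω) u v).const_mul (K ((τ - T i ω) / b n))
  rw [Finset.sum_fn] at h
  exact h.const_mul _

end Integrability

/-! ### Regularity of the transitions, stationary densities and the main theorem. -/

section Assembly

variable {Ω : Type*} [MeasurableSpace Ω] {μ : Measure Ω} {T : ℕ → Ω → ℝ} {κ : Kernel ℝ ℝ}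

lemma ae_map_of_ae_map_past (hT : ∀ i, Measurable (T i)) {p : ℝ → Prop}
    (h : ∀ᵐ x ∂(μ.map (past T 0)), p (x 0)) : ∀ᵐ x ∂(μ.map (T 0)), p x := by
  have hc : Measurable fun x : ℝ => (fun _ => x : Fin 1 → ℝ) := by fun_prop
  have heq : μ.map (past T 0) = (μ.map (T 0)).map fun x : ℝ => (fun _ => x : Fin 1 → ℝ) := by
    rw [Measure.map_map hc (hT 0)]
    congr 1
    funext ω j
    fin_cases j
    rfl
  rw [heq] at h
  exact ae_of_ae_map hc.aemeasurable h

lemma IsDensityOf.hasLipDensity {E : Type*} [NormedAddCommGroup E] [NormedSpace ℝ E]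
    [MeasureSpace E] [BorelSpace E] {g : E → ℝ} {ν : Measure E} [IsProbabilityMeasure ν]
    (hg : IsDensityOf g ν) {L : ℝ} (hL : 0 < L) (hlip : ∀ p q, |g p - g q| ≤ L * ‖p - q‖)
    (hvol : ∀ p : E, 1 ≤ volume (Metric.closedBall p (1 / L))) : HasLipDensity L ν := by
  refine ⟨g, hg.1, fun p => le_two_of_density hlip hL ?_ hvol p, hlip, hg.2⟩
  have h1 : ν univ ≤ 1 := prob_le_one
  rwa [hg.2, withDensity_apply _ MeasurableSet.univ, setLIntegral_univ] at h1

lemma IsC0.exists_le {E : Type*} [TopologicalSpace E] {f : E → ℝ} (hf : IsC0 f) :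
    ∃ B, ∀ p, f p ≤ B := by
  obtain ⟨S, hS, hS1⟩ := mem_cocompact.1 (hf.2.eventually_lt_const one_pos)
  obtain ⟨B, hB⟩ := hS.bddAbove_image hf.1.continuousOn
  refine ⟨max B 1, fun p => ?_⟩
  by_cases hp : p ∈ S
  · exact (hB (mem_image_of_mem f hp)).trans (le_max_left _ _)
  · exact (le_of_lt (hS1 hp)).trans (le_max_right _ _)

lemma HasTransition.comp_map_eq (hκ : HasTransition T μ κ) (hT : ∀ i, Measurable (T i)) :
    κ ∘ₘ (μ.map (T 0)) = μ.map (T 1) := by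
  refine Measure.ext fun s hs => ?_
  rw [Measure.bind_apply hs κ.aemeasurable, lintegral_map (Kernel.measurable_coe κ hs) (hT 0)]
  have h := hκ 0 (fun _ y => s.indicator 1 y) ((measurable_one.indicator hs).comp measurable_snd)
  simp only [lintegral_indicator_one hs] at h
  rw [← h, ← lintegral_map (measurable_one.indicator hs) (hT _), lintegral_indicator_one hs]

lemma HasTransition.twoStep_comp_map_eq [IsProbabilityMeasure μ] [IsMarkovKernel κ]
    (hκ : HasTransition T μ κ)
    (hT : ∀ i, Measurable (T i)) :
    twoStep κ ∘ₘ (μ.map (T 0)) = μ.map fun ω => (T 1 ω, T 2 ω) := by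
  have hp := measurable_past hT 0
  have h1 := hκ.condDistrib_twoStep_eq hT
  have h2 := condDistrib_comp_map (μ := μ) (X := past T 0) (Y := fun ω => (T 1 ω, T 2 ω))
    hp.aemeasurable ((hT 1).prodMk (hT 2)).aemeasurable
  rw [← h2]
  refine Measure.ext fun s hs => ?_
  rw [Measure.bind_apply hs (Kernel.aemeasurable _), Measure.bind_apply hs (Kernel.aemeasurable _),
    lintegral_map (Kernel.measurable_coe _ hs) (hT 0),
    lintegral_map (Kernel.measurable_coe _ hs) hp]
  refine lintegral_congr_ae ?_
  filter_upwards [ae_of_ae_map hp.aemeasurable h1] with ω hω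
  rw [hω]
  rfl

lemma IsDensityOf.integrable_and_integral {E : Type*} [MeasureSpace E] {g : E → ℝ} {ν : Measure E}
    [IsProbabilityMeasure ν] (hg : IsDensityOf g ν) (hgm : Measurable g) :
    Integrable g ∧ ∫ p, g p = 1 := by
  have h1 : ∫⁻ p, ENNReal.ofReal (g p) = 1 := by
    have h : ν univ = 1 := measure_univ
    rwa [hg.2, withDensity_apply _ MeasurableSet.univ, setLIntegral_univ] at h
  have h0 : 0 ≤ᵐ[volume] g := ae_of_all _ hg.1
  refine ⟨⟨hgm.aestronglyMeasurable, ?_⟩, ?_⟩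
  · rw [hasFiniteIntegral_iff_ofReal h0, h1]
    exact ENNReal.one_lt_top
  · rw [integral_eq_lintegral_of_nonneg_ae h0 hgm.aestronglyMeasurable, h1, ENNReal.toReal_one]

end Assembly

theorem theorem1 {Ω : Type*} [MeasurableSpace Ω] (μ : Measure Ω) [IsProbabilityMeasure μ]
    -- the sequence of the intervals
    (T : ℕ → Ω → ℝ) (hT : ∀ i, Measurable (T i))
    (hstat : IsStationarySeq T μ) (herg : IsErgodicSeq T μ) (hmarkov : IsMarkovSeq T μ)
    -- the marginal density `f` and the joint density `f₂` of two consecutive intervals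
    (f : ℝ → ℝ) (hf : IsDensityOf f (μ.map (T 0))) (hfC0 : IsC0 f)
    (f₂ : ℝ × ℝ → ℝ) (hf₂ : IsDensityOf f₂ (μ.map (fun ω => (T 0 ω, T 1 ω)))) (hf₂C0 : IsC0 f₂)
    -- the conditional densities of the next interval given the past
    (g : (n : ℕ) → (Fin (n + 1) → ℝ) → ℝ → ℝ)
    (hg : ∀ n, ∀ᵐ x ∂(μ.map (past T n)),
      IsDensityOf (g n x) (condDistrib (T (n + 1)) (past T n) μ x) ∧ IsC0 (g n x) ∧
        ∀ t t' : ℝ, |g n x t - g n x t'| ≤ |t - t'|)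
    -- the conditional joint densities of the next two intervals given the past
    (g₂ : (n : ℕ) → (Fin (n + 1) → ℝ) → ℝ × ℝ → ℝ)
    (hg₂ : ∀ n, ∀ᵐ x ∂(μ.map (past T n)),
      IsDensityOf (g₂ n x)
          (condDistrib (fun ω => (T (n + 1) ω, T (n + 2) ω)) (past T n) μ x) ∧
        IsC0 (g₂ n x) ∧
        ∀ τ t τ' t' : ℝ, |g₂ n x (τ, t) - g₂ n x (τ', t')| ≤ |τ - τ'| + |t - t'|)
    -- the interval `[0, M]`, and the part `[a, M]` of it near which `f` is bounded below
    (a M : ℝ) (ha : 0 ≤ a) (haM : a ≤ M) (hM : 0 < M)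
    (hfpos : ∃ ε > 0, ∃ γ > 0, ∀ t ∈ Metric.thickening ε (Icc a M), γ < f t)
    -- the conditional survival function is strictly positive
    (hS : ∀ τ ∈ Icc a M, ∀ t ∈ Icc 0 M, 0 < survival (condDensity f f₂ τ) t)
    -- the kernels
    (K₁ K₂ : ℝ → ℝ) (hK₁ : IsKernel K₁) (hK₂ : IsKernel K₂) (hK₁pos : ∀ t, 0 < K₁ t)
    (𝔏 γ : ℝ≥0) (hγ : γ ≤ 1) (hK₁H : HolderWith 𝔏 γ K₁) (hK₂H : HolderWith 𝔏 γ K₂)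
    -- the bandwidths
    (b : ℕ → ℝ) (hbpos : ∀ n, 0 < b n) (hb0 : Tendsto b atTop (𝓝 0))
    (hb : Tendsto (fun n : ℕ => n * b n ^ 4 / Real.log n) atTop atTop) :
    (∀ᵐ ω ∂μ, TendstoUniformlyOn (fun n t => hazardEst K₁ b T n ω t) (hazard f)
        atTop (Icc 0 M)) ∧
      (∀ᵐ ω ∂μ, TendstoUniformlyOn
        (fun n (p : ℝ × ℝ) => condHazardEst K₁ K₂ b T n ω p.1 p.2)
        (fun p : ℝ × ℝ => hazard (condDensity f f₂ p.1) p.2)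
        atTop (Icc a M ×ˢ Icc 0 M)) := by
  have : IsProbabilityMeasure (μ.map (T 0)) :=
    Measure.isProbabilityMeasure_map (hT 0).aemeasurable
  set κ := condDistrib (T 1) (T 0) μ
  have hκ : HasTransition T μ κ := hmarkov.hasTransition hstat hT
  have hlip : ∀ᵐ x ∂(μ.map (T 0)), HasLipDensity 1 (κ x) := by
    refine ae_map_of_ae_map_past hT ?_
    filter_upwards [hg 0, hκ.condDistrib_eq hT] with x ⟨h1, _, h2⟩ h3
    rw [← h3]
    refine h1.hasLipDensity one_pos (fun p q => ?_) fun p => ?_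
    · rw [one_mul]; exact h2 p q
    · rw [Real.volume_closedBall]; norm_num
  -- The sum of the coordinate distances is at most twice the sup norm, whence the constant `2`; the
  -- sup-norm ball of radius `1 / 2` has volume exactly `1`.
  have hlip₂ : ∀ᵐ x ∂(μ.map (T 0)), HasLipDensity 2 (twoStep κ x) := by
    refine ae_map_of_ae_map_past hT ?_
    filter_upwards [hg₂ 0, hκ.condDistrib_twoStep_eq hT] with x ⟨h1, _, h2⟩ h3
    rw [← h3]
    refine h1.hasLipDensity two_pos (fun p q => (h2 p.1 p.2 q.1 q.2).trans ?_) fun p => ?_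
    · have e1 := norm_fst_le (p - q)
      have e2 := norm_snd_le (p - q)
      rw [Real.norm_eq_abs] at e1 e2
      simp only [Prod.fst_sub, Prod.snd_sub] at e1 e2
      linarith
    · rw [← Prod.mk.eta (p := p), ← closedBall_prod_same, Measure.volume_eq_prod,
        Measure.prod_prod, Real.volume_closedBall, Real.volume_closedBall]
      norm_num
  have hdom : ∀ᵐ x ∂(μ.map (T 0)), κ x ≤ (2 : ℝ≥0∞) • volume :=
    hlip.mono fun x hx => hx.le_two_smul
  have hfκ : κ ∘ₘ (μ.map (T 0)) = volume.withDensity fun p => ENNReal.ofReal (f p) := by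
    rw [hκ.comp_map_eq hT, hstat.map_eq hT 1, hf.2]
  have hfκ₂ : twoStep κ ∘ₘ (μ.map (T 0)) = volume.withDensity fun p => ENNReal.ofReal (f₂ p) := by
    rw [hκ.twoStep_comp_map_eq hT, hstat.map_pair_eq hT 1, hf₂.2]
  obtain ⟨B, hB⟩ := hfC0.exists_le
  obtain ⟨B₂, hB₂⟩ := hf₂C0.exists_le
  have hdens := ae_tendstoUniformlyOn_densEst hκ hT hstat herg zero_le_one hlip hf.1 hfC0.1 hB hfκ
    hbpos hb0 hb hK₁ hM
  have hjoint := ae_tendstoUniformlyOn_jointDensEst hκ hT hstat herg hdom zero_le_two hlip₂ hf₂.1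
    hf₂C0.1 hB₂ hfκ₂ hbpos hb0 hb hK₁ hK₂ hM
  obtain ⟨A₁, hKA₁⟩ := hK₁.exists_isBddKernel
  obtain ⟨A₂, hKA₂⟩ := hK₂.exists_isBddKernel
  obtain ⟨ε, hε, γ₀, hγ₀, hpos⟩ := hfpos
  constructor
  · filter_upwards [hdens] with ω hω
    obtain ⟨hfi, hf1⟩ := hf.integrable_and_integral hfC0.1.measurable
    have hsurv : ∀ t ∈ Icc 0 M, survival f t ≠ 0 := fun t ht =>
      (survival_pos hf.1 hfC0.1 hfi hf1 hM.le hε hγ₀ (fun s hs => hpos s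
        (Metric.mem_thickening_iff.2 ⟨M, ⟨haM, le_rfl⟩, by
          rw [Real.dist_eq, abs_lt]; constructor <;> linarith [hs.1, hs.2]⟩)) ht).ne'
    have h := tendstoUniformlyOn_survival (X := Unit) (S := univ) hM
      (F := fun n _ => densEst K₁ b T n ω) (G := fun _ => f)
      (fun n _ _ t _ => hKA₁.intervalIntegrable_densEst n ω 0 t)
      (fun _ _ t _ => hfC0.1.intervalIntegrable 0 t)
      ((hω.comp Prod.snd).mono fun p hp => hp.2)
    have h' := (h.comp fun t : ℝ => ((), t)).mono (s' := Icc 0 M) fun t ht => ⟨mem_univ _, ht⟩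
    exact hω.div_of_isCompact isCompact_Icc h' hfC0.1.continuousOn
      (continuous_survival hfC0.1).continuousOn hsurv
  · have hfne : ∀ τ ∈ Icc a M, f τ ≠ 0 := fun τ hτ =>
      (hγ₀.trans (hpos τ (Metric.self_subset_thickening hε _ hτ))).ne'
    have hfc : ContinuousOn (fun p : ℝ × ℝ => f p.1) (Icc a M ×ˢ Icc 0 M) :=
      (hfC0.1.comp continuous_fst).continuousOn
    filter_upwards [hdens, hjoint] with ω h1 h2
    refine tendstoUniformlyOn_hazard isCompact_Icc hM
      (F := fun n => condDensity (densEst K₁ b T n ω) (jointDensEst K₁ K₂ b T n ω))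
      (fun n τ _ t _ => (hKA₂.intervalIntegrable_jointDensEst n ω τ 0 t).div_const _)
      (fun τ _ t _ => ((hf₂C0.1.comp (Continuous.prodMk_right τ)).intervalIntegrable 0 t).div_const
        _) ?_ ?_ ?_ hS
    · exact (h2.mono (prod_mono (Icc_subset_Icc_left ha) subset_rfl)).div_of_isCompact
        (isCompact_Icc.prod isCompact_Icc)
        ((h1.comp Prod.fst).mono fun p hp => Icc_subset_Icc_left ha hp.1)
        hf₂C0.1.continuousOn hfc fun p hp => hfne p.1 hp.1
    · exact hf₂C0.1.continuousOn.div hfc fun p hp => hfne p.1 hp.1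
    -- The factor `1 / f τ` leaves the integral, so joint continuity reduces to that of a parametric
    -- integral of `f₂`.
    · simp only [survival, condDensity, intervalIntegral.integral_div]
      refine continuousOn_const.sub (ContinuousOn.div ?_ hfc fun p hp => hfne p.1 hp.1)
      exact (intervalIntegral.continuous_parametric_intervalIntegral_of_continuous
        (f := fun (p : ℝ × ℝ) s => f₂ (p.1, s)) (hf₂C0.1.comp (by fun_prop))
        continuous_snd).continuousOn
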